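/- Let $n\ge 3$ be an integer. For $\Lambda\subset\mathbb{C}$ let $\mathcal{H}^*_{n|\Lambda}$ be the space of normal complex $n\times n$ matrices (those commuting with their adjoints) whose spectrum is contained in $\Lambda$, with the topology inherited from $M_n(\mathbb{C})$. A map $\phi$ from a set $D\subseteq M_n(\mathbb{C})$ to $M_n(\mathbb{C})$ is commutativity-preserving if $\phi(X)\phi(Y)=\phi(Y)\phi(X)$ whenever $X,Y\in D$ commute, and spectrum-preserving if $\phi(X)$ and $X$ have the same spectrum (set of eigenvalues) for every $X\in D$. It is a conjugation if there is $T\in GL(n,\mathbb{C})$ with $\phi(X)=TXT^{-1}$ for all $X\in D$, and a transpose conjugation if there is $T\in GL(n,\mathbb{C})$ with $\phi(X)=TX^{t}T^{-1}$ for all $X\in D$. Let $\Lambda\subset\mathbb{C}$ be a simple closed curve, i.e. a subspace homeomorphic to the circle. Then the continuous, commutativity- and spectrum-preserving maps $\phi:\mathcal{H}^*_{n|\Lambda}\to M_n(\mathbb{C})$ are precisely the conjugations and the transpose conjugations. In particular, no such map $\phi$ is an ordering of spectra: if $I\subseteq\mathbb{R}$ is an interval and $\gamma:I\to\mathbb{C}$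 is a continuous injection with image $\Lambda$, there is no $T\in GL(n,\mathbb{C})$ such that $\phi(X)=T\,\mathrm{diag}(\lambda_1(X),\dots,\lambda_n(X))\,T^{-1}$ for all $X\in\mathcal{H}^*_{n|\Lambda}$, where $\lambda_1(X),\dots,\lambda_n(X)$ are the eigenvalues of $X$ with multiplicity, arranged so that $\gamma^{-1}(\lambda_i(X))$ is non-decreasing in $i$. Moreover, for $\Lambda=S^1$ (the unit circle): the continuous, commutativity- and spectrum-preserving maps from the unitary group $U(n)$ to $M_n(\mathbb{C})$ are precisely the conjugations and the transpose conjugations. -/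

import Mathlib

/-- A simple closed curve in the plane: a subspace of `ℂ` homeomorphic to the circle. -/
def IsSimpleClosedCurve (Λ : Set ℂ) : Prop :=
  Nonempty (Λ ≃ₜ Circle)

/-- The normal complex `n × n` matrices (those commuting with their adjoints)
whose spectrum is contained in `Λ`. -/
def normalMatrices (n : ℕ) (Λ : Set ℂ) : Set (Matrix (Fin n) (Fin n) ℂ) :=
  {X | IsStarNormal X ∧ spectrum ℂ X ⊆ Λ}

/-- The map `φ`, defined on a set `D` of matrices, sends commuting matrices to commuting ones. -/
def PreservesCommutativity {n : ℕ} {D : Set (Matrix (Fin n) (Fin n) ℂ)}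
    (φ : D → Matrix (Fin n) (Fin n) ℂ) : Prop :=
  ∀ X Y : D, Commute (X : Matrix (Fin n) (Fin n) ℂ) (Y : Matrix (Fin n) (Fin n) ℂ) →
    Commute (φ X) (φ Y)

/-- The map `φ` preserves spectra (as sets of eigenvalues). -/
def PreservesSpectrum {n : ℕ} {D : Set (Matrix (Fin n) (Fin n) ℂ)}
    (φ : D → Matrix (Fin n) (Fin n) ℂ) : Prop :=
  ∀ X : D, spectrum ℂ (φ X) = spectrum ℂ (X : Matrix (Fin n) (Fin n) ℂ)

/-- `φ` is a conjugation `X ↦ T X T⁻¹` by some invertible complex matrix `T`. -/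
def IsConjugation {n : ℕ} {D : Set (Matrix (Fin n) (Fin n) ℂ)}
    (φ : D → Matrix (Fin n) (Fin n) ℂ) : Prop :=
  ∃ T : (Matrix (Fin n) (Fin n) ℂ)ˣ, ∀ X : D,
    φ X = (T : Matrix (Fin n) (Fin n) ℂ) * (X : Matrix (Fin n) (Fin n) ℂ) *
      ((T⁻¹ : (Matrix (Fin n) (Fin n) ℂ)ˣ) : Matrix (Fin n) (Fin n) ℂ)

/-- `φ` is a transpose conjugation `X ↦ T Xᵗ T⁻¹` for some invertible complex matrix `T`. -/
def IsTransposeConjugation {n : ℕ} {D : Set (Matrix (Fin n) (Fin n) ℂ)}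
    (φ : D → Matrix (Fin n) (Fin n) ℂ) : Prop :=
  ∃ T : (Matrix (Fin n) (Fin n) ℂ)ˣ, ∀ X : D,
    φ X = (T : Matrix (Fin n) (Fin n) ℂ) * (X : Matrix (Fin n) (Fin n) ℂ).transpose *
      ((T⁻¹ : (Matrix (Fin n) (Fin n) ℂ)ˣ) : Matrix (Fin n) (Fin n) ℂ)

/-- `φ` lists spectra along the curve `γ` (injective and defined on the interval `I`):
`φ X = T diag(λ₁, …, λₙ) T⁻¹` with `T` fixed, where `λᵢ = γ (tᵢ)` are the eigenvalues of `X`,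
counted with multiplicity, ordered so that the parameters `tᵢ ∈ I` are non-decreasing. -/
def IsSpectrumOrdering {n : ℕ} {D : Set (Matrix (Fin n) (Fin n) ℂ)} (I : Set ℝ) (γ : ℝ → ℂ)
    (φ : D → Matrix (Fin n) (Fin n) ℂ) : Prop :=
  ∃ T : (Matrix (Fin n) (Fin n) ℂ)ˣ, ∀ X : D, ∃ t : Fin n → ℝ,
    Monotone t ∧ (∀ i, t i ∈ I) ∧
    (X : Matrix (Fin n) (Fin n) ℂ).charpoly.roots =
      Multiset.map (fun i => γ (t i)) Finset.univ.val ∧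
    φ X = (T : Matrix (Fin n) (Fin n) ℂ) * Matrix.diagonal (fun i => γ (t i)) *
      ((T⁻¹ : (Matrix (Fin n) (Fin n) ℂ)ˣ) : Matrix (Fin n) (Fin n) ℂ)

/-!
Let `φ` be continuous, commutativity- and spectrum-preserving on the normal matrices with spectrum
in a simple closed curve `Λ`.

*One orthonormal basis.* On the matrices `U diag(z) U*` with `U` a fixed unitary, the values of `φ`
commute, so they are diagonal in the eigenbasis of one value with distinct eigenvalues, and `φ`
selects continuously, for each diagonal place, one of the entries of `z ∈ Λⁿ`. The tuples whose
`i`-th entry differs from all others form a connected dense set, because a circle minus a point is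
an interval. Hence the selection at each place always picks the same entry
(`eq_of_continuous_selection`), and `φ (U diag(z) U*) = T diag(z) T⁻¹` for some `T` depending on
`U` (`exists_conj_on_diagonal`). For an interval in place of a circle this fails, and orderings
of spectra appear.

*A map on lines.* It follows that `φ (∑ zᵢ Pᵢ) = ∑ zᵢ Φ(Pᵢ)` for rank-one orthogonal projections
`Pᵢ` with sum `1`, where `Φ` is continuous, takes rank-one idempotents as values, and sends
orthogonal frames to frames of idempotents (`IsFrameMap`, `isFrameMap_inducedMap`).

*Coordinatisation.* Normalise `Φ` so that the standard frame is preserved. Compressing to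
coordinate planes shows that the entries of `Φ` at a line are governed by its values on lines in
coordinate planes. There it is described by slope functions `ℂ → ℂ`, once one knows that only the
axes are sent to axes (`IsStandardFrameMap.nondegenerate`, a connectedness argument). A third
coordinate makes the slope function multiplicative, and orthogonality of `(1, 1, 1)` to
`(1, a, -1 - a)` makes it additive. A continuous field endomorphism of `ℂ` is the identity or the
conjugation, and so `Φ` is conjugate to the identity or to the transposition of projections
(`IsFrameMap.exists_conj`). By the spectral theorem the same holds for `φ`.

Finally the values of an ordering of spectra commute, those of a conjugation or a transpose
conjugation do not; and unitary matrices are the normal ones with spectrum in the unit circle.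
-/

open Matrix

/-! ### Projections onto lines, orthogonal frames and diagonalisation -/

lemma euclidean_inner_eq {n : ℕ} (x y : EuclideanSpace ℂ (Fin n)) :
    inner ℂ x y = star (x.ofLp) ⬝ᵥ y.ofLp := by
  rw [EuclideanSpace.inner_eq_star_dotProduct, dotProduct_comm]

lemma star_dotProduct_self_eq_norm {n : ℕ} (v : Fin n → ℂ) :
    star v ⬝ᵥ v = (‖WithLp.toLp 2 v‖ : ℂ) * ‖WithLp.toLp 2 v‖ := by
  rw [← sq]
  exact (euclidean_inner_eq (WithLp.toLp 2 v) (WithLp.toLp 2 v)).symm.trans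
    (inner_self_eq_norm_sq_to_K _)

lemma norm_toLp_ne_zero {n : ℕ} {v : Fin n → ℂ} (hv : v ≠ 0) :
    (‖WithLp.toLp 2 v‖ : ℂ) ≠ 0 := by
  simpa using hv

/-- The orthogonal projection `v v* / (v* v)` of `ℂⁿ` onto the line spanned by `v`. -/
noncomputable def lineProj {n : ℕ} (v : Fin n → ℂ) : Matrix (Fin n) (Fin n) ℂ :=
  (star v ⬝ᵥ v)⁻¹ • vecMulVec v (star v)

lemma dotProduct_star_self_ne_zero {n : ℕ} {v : Fin n → ℂ} (hv : v ≠ 0) :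
    star v ⬝ᵥ v ≠ 0 := by
  rw [star_dotProduct_self_eq_norm]
  exact mul_ne_zero (norm_toLp_ne_zero hv) (norm_toLp_ne_zero hv)

lemma lineProj_smul {n : ℕ} (c : ℂ) (hc : c ≠ 0) (v : Fin n → ℂ) :
    lineProj (c • v) = lineProj v := by
  unfold lineProj
  have hc' : star c ≠ 0 := star_ne_zero.2 hc
  simp only [star_smul, smul_dotProduct, dotProduct_smul, smul_vecMulVec, vecMulVec_smul,
    smul_smul, smul_eq_mul]
  congr 1
  by_cases h : star v ⬝ᵥ v = 0
  · simp [h]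
  · field_simp

lemma continuousOn_lineProj {n : ℕ} :
    ContinuousOn (lineProj (n := n)) {0}ᶜ := by
  have h : Continuous fun v : Fin n → ℂ => star v := continuous_star
  refine ContinuousOn.smul (ContinuousOn.inv₀ (h.dotProduct continuous_id).continuousOn ?_)
    (continuous_id.matrix_vecMulVec h).continuousOn
  intro v hv
  exact dotProduct_star_self_ne_zero hv

/-- An orthogonal family of `n` nonzero vectors of `ℂⁿ` yields, after normalisation, the columns
of a unitary matrix `U`; combinations of the corresponding projections are then exactly the
matrices `U diag(d) U*`. -/
lemma exists_unitary_of_orthogonal {n : ℕ} (v : Fin n → Fin n → ℂ) (hv : ∀ i, v i ≠ 0)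
    (ho : Pairwise fun i j => star (v i) ⬝ᵥ v j = 0) :
    ∃ U ∈ unitaryGroup (Fin n) ℂ, ∀ d : Fin n → ℂ,
      U * diagonal d * star U = ∑ i, d i • lineProj (v i) := by
  set r : Fin n → ℝ := fun i => ‖WithLp.toLp 2 (v i)‖
  have hr0 : ∀ i, (r i : ℂ) ≠ 0 := fun i => norm_toLp_ne_zero (hv i)
  have hr : ∀ i, star (v i) ⬝ᵥ v i = (r i : ℂ) * r i := fun i => star_dotProduct_self_eq_norm _
  set U : Matrix (Fin n) (Fin n) ℂ := of fun i k => (r k : ℂ)⁻¹ * v k i with hU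
  have hUU : star U * U = 1 := by
    ext k l
    have : (star U * U) k l = (r k : ℂ)⁻¹ * (r l : ℂ)⁻¹ * (star (v k) ⬝ᵥ v l) := by
      simp only [mul_apply, hU, star_apply, of_apply, dotProduct, Finset.mul_sum, Pi.star_apply]
      refine Finset.sum_congr rfl fun i _ => ?_
      simp
      ring
    rw [this]
    by_cases hkl : k = l
    · subst hkl
      have := hr0 k
      rw [hr, one_apply_eq]
      field_simp
    · rw [ho hkl, one_apply_ne hkl, mul_zero]
  refine ⟨U, mem_unitaryGroup_iff'.2 hUU, fun d => ?_⟩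
  ext i j
  rw [Matrix.sum_apply, mul_apply]
  refine Finset.sum_congr rfl fun k _ => ?_
  have := hr0 k
  simp only [mul_diagonal, hU, star_apply, of_apply, lineProj, Matrix.smul_apply, vecMulVec_apply, hr,
    smul_eq_mul, Pi.star_apply, star_mul', star_inv₀, Complex.star_def, Complex.conj_ofReal]
  field_simp

/-- Two orthogonal nonzero vectors are members of an orthogonal frame. -/
lemma exists_orthogonal_extension {n : ℕ} {v w : Fin n → ℂ} (hv : v ≠ 0) (hw : w ≠ 0)
    (hvw : star v ⬝ᵥ w = 0) {i j : Fin n} (hij : i ≠ j) :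
    ∃ u : Fin n → Fin n → ℂ, u i = v ∧ u j = w ∧ (∀ k, u k ≠ 0) ∧
      Pairwise fun k l => star (u k) ⬝ᵥ u l = 0 := by
  have hwv : star w ⬝ᵥ v = 0 := by rw [star_dotProduct, hvw, star_zero]
  set c : Fin n → ℂ := fun k =>
    if k = i then (‖WithLp.toLp 2 v‖ : ℂ) else if k = j then (‖WithLp.toLp 2 w‖ : ℂ) else 1
  have hci : c i = (‖WithLp.toLp 2 v‖ : ℂ) := by simp [c]
  have hcj : c j = (‖WithLp.toLp 2 w‖ : ℂ) := by simp [c, hij.symm]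
  have hc : ∀ k, c k ≠ 0 := by
    intro k
    have h1 := norm_toLp_ne_zero hv
    have h2 := norm_toLp_ne_zero hw
    simp only [c]
    split_ifs <;> first | assumption | exact one_ne_zero
  set e : Fin n → EuclideanSpace ℂ (Fin n) := fun k =>
    if k = i then (c i)⁻¹ • WithLp.toLp 2 v else (c j)⁻¹ • WithLp.toLp 2 w
  have hei : e i = (c i)⁻¹ • WithLp.toLp 2 v := by simp [e]
  have hej : e j = (c j)⁻¹ • WithLp.toLp 2 w := by simp [e, hij.symm]
  have horth : Orthonormal ℂ (({i, j} : Set (Fin n)).domRestrict e) := by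
    have hni : ‖e i‖ = 1 := by
      have := norm_toLp_ne_zero hv
      rw [hei, norm_smul, hci]
      simp only [norm_inv, Complex.norm_real, norm_norm]
      exact inv_mul_cancel₀ (by exact_mod_cast this)
    have hnj : ‖e j‖ = 1 := by
      have := norm_toLp_ne_zero hw
      rw [hej, norm_smul, hcj]
      simp only [norm_inv, Complex.norm_real, norm_norm]
      exact inv_mul_cancel₀ (by exact_mod_cast this)
    have h1 : inner ℂ (e i) (e j) = 0 := by
      rw [hei, hej, inner_smul_left, inner_smul_right, euclidean_inner_eq]
      simp [hvw]
    have h2 : inner ℂ (e j) (e i) = 0 := by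
      rw [hei, hej, inner_smul_left, inner_smul_right, euclidean_inner_eq]
      simp [hwv]
    refine ⟨?_, ?_⟩
    · rintro ⟨k, rfl | rfl⟩
      · exact hni
      · exact hnj
    · rintro ⟨k, rfl | rfl⟩ ⟨l, rfl | rfl⟩ hkl
      · exact absurd rfl hkl
      · exact h1
      · exact h2
      · exact absurd rfl hkl
  obtain ⟨b, hb⟩ := horth.exists_orthonormalBasis_extension_of_card_eq (by simp)
  refine ⟨fun k => c k • (b k).ofLp, ?_, ?_, ?_, ?_⟩
  · have := hc i
    simp [hb i (by simp), hei, this]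
  · have := hc j
    simp [hb j (by simp), hej, this]
  · intro k hk
    have h1 := b.orthonormal.ne_zero k
    refine h1 ?_
    simpa [hc k] using hk
  · intro k l hkl
    have : inner ℂ (b k) (b l) = 0 := b.orthonormal.2 hkl
    rw [euclidean_inner_eq] at this
    simp [this]

/-- Every nonzero vector is a member of an orthogonal frame. -/
lemma exists_orthogonal_frame {n : ℕ} (hn : 3 ≤ n) {v : Fin n → ℂ} (hv : v ≠ 0) :
    ∃ (u : Fin n → Fin n → ℂ) (i : Fin n), u i = v ∧ (∀ k, u k ≠ 0) ∧
      Pairwise fun k l => star (u k) ⬝ᵥ u l = 0 := by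
  have hij : (⟨0, by omega⟩ : Fin n) ≠ ⟨1, by omega⟩ := by simp
  obtain ⟨w, hw, h⟩ : ∃ w : Fin n → ℂ, w ≠ 0 ∧ star v ⬝ᵥ w = 0 := by
    generalize (⟨0, by omega⟩ : Fin n) = i at hij
    generalize (⟨1, by omega⟩ : Fin n) = j at hij
    by_cases h0 : v i = 0
    · exact ⟨Pi.single i 1, by simp, by simp [h0]⟩
    · refine ⟨Pi.single i (-star (v j)) + Pi.single j (star (v i)), fun h => ?_, ?_⟩
      · have := congrFun h j
        simp [hij.symm, h0] at this
      · simp [dotProduct_add]; ring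
  obtain ⟨u, hu0, -, hu, ho⟩ := exists_orthogonal_extension hv hw h hij
  exact ⟨u, _, hu0, hu, ho⟩

/-- The spectral theorem for normal matrices: they are unitarily diagonalisable. An orthonormal
basis adapted to the joint eigenspaces of the commuting Hermitian matrices `X + X*` and
`i (X - X*)` does it. -/
lemma exists_unitary_diagonalization {n : ℕ} (X : Matrix (Fin n) (Fin n) ℂ)
    (hX : IsStarNormal X) :
    ∃ U ∈ unitaryGroup (Fin n) ℂ, ∃ d : Fin n → ℂ, X = U * diagonal d * star U := by
  have hc : star X * X = X * star X := hX.star_comm_self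
  set A := X + star X
  set B := Complex.I • (X - star X)
  have hA : A.toEuclideanLin.IsSymmetric := by
    rw [isSymmetric_toEuclideanLin_iff]
    change star A = A
    simp [A, add_comm]
  have hB : B.toEuclideanLin.IsSymmetric := by
    rw [isSymmetric_toEuclideanLin_iff]
    change star B = B
    simp only [B, star_smul, star_sub, star_star, Complex.star_def, Complex.conj_I]
    module
  have hAB : A * B = B * A := by
    simp only [A, B, Algebra.mul_smul_comm, smul_mul, mul_sub, add_mul, mul_add, sub_mul, hc]
    module
  have hAB' : Commute A.toEuclideanLin B.toEuclideanLin := by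
    change A.toEuclideanLin * B.toEuclideanLin = B.toEuclideanLin * A.toEuclideanLin
    rw [Module.End.mul_eq_comp, Module.End.mul_eq_comp, ← toLpLin_mul_same, ← toLpLin_mul_same,
      hAB]
  have hint := LinearMap.IsSymmetric.directSum_isInternal_of_commute hA hB hAB'
  have hof := LinearMap.IsSymmetric.orthogonalFamily_eigenspace_inf_eigenspace hA hB
  -- only finitely many joint eigenspaces are nonzero
  have hfin := Submodule.finite_ne_bot_of_iSupIndep hint.submodule_iSupIndep
  have : Fintype {i : ℂ × ℂ // Module.End.eigenspace A.toEuclideanLin i.2 ⊓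
      Module.End.eigenspace B.toEuclideanLin i.1 ≠ ⊥} := hfin.fintype
  have hint' := DirectSum.isInternal_ne_bot_iff.2 hint
  have hof' := hof.comp (Subtype.val_injective (p := fun i : ℂ × ℂ =>
    Module.End.eigenspace A.toEuclideanLin i.2 ⊓ Module.End.eigenspace B.toEuclideanLin i.1 ≠ ⊥))
  set b := hint'.subordinateOrthonormalBasis (n := n) (by simp) hof'
  have hb : ∀ k, ∃ μ : ℂ, X *ᵥ (b k).ofLp = μ • (b k).ofLp := by
    intro k
    obtain ⟨h1, h2⟩ := hint'.subordinateOrthonormalBasis_subordinate (n := n) (by simp) k hof'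
    replace h1 := Module.End.mem_eigenspace_iff.1 h1
    replace h2 := Module.End.mem_eigenspace_iff.1 h2
    set α := (hint'.subordinateOrthonormalBasisIndex (n := n) (by simp) k hof').1.2
    set β := (hint'.subordinateOrthonormalBasisIndex (n := n) (by simp) k hof').1.1
    have h1' : A *ᵥ (b k).ofLp = α • (b k).ofLp := congrArg WithLp.ofLp h1
    have h2' : B *ᵥ (b k).ofLp = β • (b k).ofLp := congrArg WithLp.ofLp h2
    have hXAB : X = (1 / 2 : ℂ) • A - (Complex.I / 2) • B := by
      simp only [A, B, smul_smul, div_mul_eq_mul_div, Complex.I_mul_I]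
      module
    refine ⟨(α - Complex.I * β) / 2, ?_⟩
    rw [hXAB, sub_mulVec, smul_mulVec, smul_mulVec, h1', h2']
    module
  choose d hd using hb
  obtain ⟨U, hU, hUd⟩ := exists_unitary_of_orthogonal (fun k => (b k).ofLp)
    (fun k hk => b.orthonormal.ne_zero k (by simpa using hk)) (fun k l hkl => by
      have : inner ℂ (b k) (b l) = 0 := b.orthonormal.2 hkl
      rwa [euclidean_inner_eq] at this)
  refine ⟨U, hU, d, ?_⟩
  have h1 := hUd fun _ => 1
  simp only [one_smul, diagonal_one, mul_one] at h1
  rw [mem_unitaryGroup_iff.1 hU] at h1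
  rw [hUd, ← mul_one X, h1, Finset.mul_sum]
  refine Finset.sum_congr rfl fun k _ => ?_
  rw [lineProj, mul_smul_comm, mul_vecMulVec, hd, smul_vecMulVec, smul_comm]

/-- A matrix with `n` distinct eigenvalues is diagonalisable. -/
lemma exists_diagonalization_of_injective {n : ℕ} (A : Matrix (Fin n) (Fin n) ℂ) (μ : Fin n → ℂ)
    (hμ : Function.Injective μ) (hA : ∀ i, μ i ∈ spectrum ℂ A) :
    ∃ T : (Matrix (Fin n) (Fin n) ℂ)ˣ, A = T.1 * diagonal μ * T⁻¹.1 := by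
  have hev : ∀ i, Module.End.HasEigenvalue (toLin' A) (μ i) := fun i => by
    rw [Module.End.hasEigenvalue_iff_mem_spectrum, spectrum_toLin']; exact hA i
  choose x hx using fun i => (hev i).exists_hasEigenvector
  have hli := Module.End.eigenvectors_linearIndependent' (toLin' A) μ hμ x hx
  have hT : IsUnit (of x)ᵀ := by
    rw [isUnit_transpose, ← linearIndependent_rows_iff_isUnit]
    exact hli
  obtain ⟨T, hT⟩ := hT
  refine ⟨T, ?_⟩
  have h : A * T.1 = T.1 * diagonal μ := by
    ext i k
    have := congrFun (hx k).apply_eq_smul i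
    rw [hT, mul_diagonal, mul_apply]
    simp only [toLin'_apply, mulVec, dotProduct, Pi.smul_apply, smul_eq_mul] at this
    simp [this, mul_comm]
  rw [← h, mul_assoc, ← Units.val_mul, mul_inv_cancel, Units.val_one, mul_one]

lemma eq_diagonal_of_commute {n : ℕ} {μ : Fin n → ℂ} (hμ : Function.Injective μ)
    {A : Matrix (Fin n) (Fin n) ℂ} (hA : Commute (diagonal μ) A) :
    A = diagonal fun i => A i i := by
  ext i j
  by_cases hij : i = j
  · subst hij; simp
  · have := congrFun (congrFun hA.eq i) j
    rw [diagonal_mul, mul_diagonal] at this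
    have h2 : (μ i - μ j) * A i j = 0 := by linear_combination this
    rw [diagonal_apply_ne _ hij]
    exact (mul_eq_zero.1 h2).resolve_left (sub_ne_zero.2 fun h => hij (hμ h))

/-! ### The maps on a maximal torus -/

lemma mem_normalMatrices_of_unitary {n : ℕ} {Λ : Set ℂ} {U : Matrix (Fin n) (Fin n) ℂ}
    (hU : U ∈ unitaryGroup (Fin n) ℂ) {d : Fin n → ℂ} (hd : ∀ i, d i ∈ Λ) :
    U * diagonal d * star U ∈ normalMatrices n Λ := by
  have h1 := mem_unitaryGroup_iff.1 hU
  have h2 := mem_unitaryGroup_iff'.1 hU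
  refine ⟨⟨?_⟩, ?_⟩
  · change star (U * diagonal d * star U) * (U * diagonal d * star U) =
      (U * diagonal d * star U) * star (U * diagonal d * star U)
    have h3 : star (U * diagonal d * star U) = U * star (diagonal d) * star U := by
      simp [mul_assoc]
    have h4 : ∀ A B : Matrix (Fin n) (Fin n) ℂ,
        (U * A * star U) * (U * B * star U) = U * (A * B) * star U := by
      intro A B
      calc _ = U * A * (star U * U) * B * star U := by simp only [mul_assoc]
        _ = _ := by rw [h2]; simp only [mul_assoc, one_mul]
    rw [h3, h4, h4, star_eq_conjTranspose, diagonal_conjTranspose,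
      (commute_diagonal _ _).eq]
  · have := Unitary.spectrum_star_right_conjugate (R := ℂ) (a := diagonal d)
      (U := ⟨U, hU⟩)
    simp only at this
    rw [this, spectrum_diagonal]
    rintro _ ⟨i, rfl⟩
    exact hd i

/-- The key continuity argument. Let `ψ` assign continuously to `z ∈ (S¹)ⁿ` a list of points among
`γ (z 1), …, γ (z n)`, where `γ` is injective, and suppose that `ψ` does not move the list at
one tuple `z₀` of distinct points. Then it never does. For, the tuples `z` whose `i`-th entry
differs from all others form a connected set, on which `ψ z i = γ (z i)` is a clopen
condition; and that set is dense. -/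
lemma eq_of_continuous_selection {n : ℕ} {γ : Circle → ℂ} (hγ : Continuous γ)
    (hγi : Function.Injective γ) {ψ : (Fin n → Circle) → Fin n → ℂ} (hψ : Continuous ψ)
    (hmem : ∀ z i, ∃ k, ψ z i = γ (z k)) {z₀ : Fin n → Circle} (hz₀ : Function.Injective z₀)
    (h₀ : ∀ i, ψ z₀ i = γ (z₀ i)) (z : Fin n → Circle) (i : Fin n) : ψ z i = γ (z i) := by
  -- `z i = exp (t i)`, and `t k` is the angle from the antipode of `z i` to `z k`
  set p : (Fin n → ℝ) → Fin n → Circle := fun t k =>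
    if k = i then Circle.exp (t i) else Circle.exp (t i + Real.pi + t k) with hp
  have hpc : Continuous p := by
    refine continuous_pi fun k => ?_
    by_cases hk : k = i
    · simp only [hp, hk, if_true]; fun_prop
    · simp only [hp, hk, if_false]; fun_prop
  have hpi : ∀ t, p t i = Circle.exp (t i) := fun t => by simp [hp]
  have hpk : ∀ t k, k ≠ i → p t k = Circle.exp (t i + Real.pi + t k) := fun t k hk => by
    simp [hp, hk]
  set I : Fin n → Set ℝ := fun k => if k = i then Set.univ else Set.Ioo (-Real.pi) Real.pi with hI
  set S : Set (Fin n → ℝ) := Set.univ.pi I with hS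
  have hSconn : IsPreconnected S := by
    refine isPreconnected_univ_pi fun k => ?_
    simp only [hI]
    split_ifs
    · exact isPreconnected_univ
    · exact isPreconnected_Ioo
  set A : Set (Fin n → ℝ) := {t | ψ (p t) i = γ (p t i)}
  set B : Set (Fin n → ℝ) := ⋃ k : {k // k ≠ i}, {t | ψ (p t) i = γ (p t k)}
  have hA : IsClosed A := isClosed_eq
    ((continuous_apply i).comp (hψ.comp hpc)) (hγ.comp ((continuous_apply i).comp hpc))
  have hB : IsClosed B := isClosed_iUnion_of_finite fun k => isClosed_eq
    ((continuous_apply i).comp (hψ.comp hpc)) (hγ.comp ((continuous_apply k.1).comp hpc))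
  have hSAB : S ⊆ A ∪ B := by
    intro t _
    obtain ⟨k, hk⟩ := hmem (p t) i
    by_cases hki : k = i
    · subst hki; exact Or.inl hk
    · exact Or.inr (Set.mem_iUnion.2 ⟨⟨k, hki⟩, hk⟩)
  have hdisj : S ∩ (A ∩ B) = ∅ := by
    rw [Set.eq_empty_iff_forall_notMem]
    rintro t ⟨htS, htA, htB⟩
    obtain ⟨⟨k, hki⟩, hk⟩ := Set.mem_iUnion.1 htB
    have h1 : p t i = p t k := hγi (htA.symm.trans hk)
    rw [hpi, hpk t k hki, Circle.exp_eq_exp] at h1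
    obtain ⟨m, hm⟩ := h1
    have htk : t k ∈ Set.Ioo (-Real.pi) Real.pi := by
      have := htS k (Set.mem_univ k)
      simpa [hI, hki] using this
    have hπ := Real.pi_pos
    have h2 : t k = (-2 * m - 1 : ℝ) * Real.pi := by linarith
    rw [h2] at htk
    obtain ⟨h3, h4⟩ := htk
    have h5 : (-1 : ℝ) < -2 * m - 1 := by nlinarith
    have h6 : (-2 * m - 1 : ℝ) < 1 := by nlinarith
    have h5' : (-1 : ℤ) < -2 * m - 1 := by exact_mod_cast h5
    have h6' : (-2 * m - 1 : ℤ) < 1 := by exact_mod_cast h6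
    omega
  -- every tuple has such angles in the half-open interval `(-π, π]`
  have hsurj : ∀ w : Fin n → Circle, ∃ t, p t = w ∧ ∀ k, k ≠ i →
      t k ∈ Set.Ioc (-Real.pi) Real.pi ∧ (w k ≠ w i → t k ≠ Real.pi) := by
    intro w
    set θ : Circle → ℝ := fun x => Complex.arg x
    have hθ : ∀ x, Circle.exp (θ x) = x := Circle.exp_arg
    set t : Fin n → ℝ := fun k =>
      if k = i then θ (w i) else θ (w k / (w i * Circle.exp Real.pi)) with ht
    have hti : t i = θ (w i) := by simp [ht]
    have htk : ∀ k, k ≠ i → t k = θ (w k / (w i * Circle.exp Real.pi)) := fun k hk => by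
      simp [ht, hk]
    refine ⟨t, ?_, ?_⟩
    · funext k
      by_cases hk : k = i
      · rw [hk, hpi, hti, hθ]
      · rw [hpk _ _ hk, hti, htk k hk, Circle.exp_add, Circle.exp_add, hθ, hθ, mul_div_cancel]
    · intro k hk
      rw [htk k hk]
      refine ⟨⟨Complex.neg_pi_lt_arg _, Complex.arg_le_pi _⟩, fun hne h => hne ?_⟩
      have h1 := hθ (w k / (w i * Circle.exp Real.pi))
      rw [h, eq_div_iff_mul_eq', mul_left_comm, ← Circle.exp_add, ← two_mul, Circle.exp_two_pi,
        mul_one] at h1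
      exact h1.symm
  have hSA : S ⊆ A := by
    rcases isPreconnected_iff_subset_of_disjoint_closed.1 hSconn A B hA hB hSAB hdisj with h | h
    · exact h
    · exfalso
      obtain ⟨t, ht, htk⟩ := hsurj z₀
      have htS : t ∈ S := by
        intro k _
        by_cases hk : k = i
        · simp [hI, hk]
        · simp only [hI, hk, if_false]
          obtain ⟨⟨h1, h2⟩, h3⟩ := htk k hk
          exact ⟨h1, lt_of_le_of_ne h2 (h3 fun he => hk (hz₀ he))⟩
      have htA : t ∈ A := by
        change ψ (p t) i = γ (p t i)
        rw [ht]; exact h₀ i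
      have : t ∈ S ∩ (A ∩ B) := ⟨htS, htA, h htS⟩
      rw [hdisj] at this
      exact this
  obtain ⟨t, ht, htk⟩ := hsurj z
  have htS : t ∈ closure S := by
    rw [hS, closure_pi_set]
    intro k _
    by_cases hk : k = i
    · simp [hI, hk]
    · simp only [hI, hk, if_false]
      rw [closure_Ioo (by linarith [Real.pi_pos])]
      exact Set.Ioc_subset_Icc_self (htk k hk).1
  have := closure_minimal hSA hA htS
  rw [← ht]
  exact this

/-- On the normal matrices that are diagonal in a fixed orthonormal basis, `φ` is a conjugation; the
matrix `T` may depend on that basis. -/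
lemma exists_conj_on_diagonal {n : ℕ} {Λ : Set ℂ} (hΛ : IsSimpleClosedCurve Λ)
    {φ : normalMatrices n Λ → Matrix (Fin n) (Fin n) ℂ} (hc : Continuous φ)
    (hcomm : PreservesCommutativity φ) (hspec : PreservesSpectrum φ)
    {U : Matrix (Fin n) (Fin n) ℂ} (hU : U ∈ unitaryGroup (Fin n) ℂ) :
    ∃ T : (Matrix (Fin n) (Fin n) ℂ)ˣ, ∀ (d : Fin n → ℂ) (hd : ∀ i, d i ∈ Λ),
      φ ⟨U * diagonal d * star U, mem_normalMatrices_of_unitary hU hd⟩ =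
        T.1 * diagonal d * T⁻¹.1 := by
  obtain ⟨e⟩ := hΛ
  set γ : Circle → ℂ := fun z => (e.symm z : ℂ) with hγdef
  have hγ : Continuous γ := continuous_subtype_val.comp e.symm.continuous
  have hγi : Function.Injective γ := Subtype.val_injective.comp e.symm.injective
  have hγmem : ∀ z, γ z ∈ Λ := fun z => (e.symm z).2
  set X : (Fin n → Circle) → normalMatrices n Λ := fun z =>
    ⟨U * diagonal (fun i => γ (z i)) * star U,
      mem_normalMatrices_of_unitary hU fun i => hγmem (z i)⟩ with hX
  have hXc : Continuous X := by
    refine Continuous.subtype_mk ?_ _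
    have h1 : Continuous fun (z : Fin n → Circle) i => γ (z i) :=
      continuous_pi fun i => hγ.comp (continuous_apply i)
    exact (continuous_const.mul h1.matrix_diagonal).mul continuous_const
  have hUU := mem_unitaryGroup_iff'.1 hU
  have hXcomm : ∀ z w, Commute (φ (X z)) (φ (X w)) := by
    intro z w
    refine hcomm _ _ ?_
    have h4 : ∀ A B : Matrix (Fin n) (Fin n) ℂ,
        (U * A * star U) * (U * B * star U) = U * (A * B) * star U := by
      intro A B
      calc _ = U * A * (star U * U) * B * star U := by simp only [mul_assoc]
        _ = _ := by rw [hUU]; simp only [mul_assoc, one_mul]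
    change U * _ * star U * (U * _ * star U) = U * _ * star U * (U * _ * star U)
    rw [h4, h4, (commute_diagonal _ _).eq]
  have hXspec : ∀ z, spectrum ℂ (φ (X z)) = Set.range fun i => γ (z i) := by
    intro z
    rw [hspec]
    have := Unitary.spectrum_star_right_conjugate (R := ℂ) (a := diagonal fun i => γ (z i))
      (U := ⟨U, hU⟩)
    simp only at this
    rw [← spectrum_diagonal, ← this]
  obtain ⟨z₀, hz₀⟩ : ∃ z₀ : Fin n → Circle, Function.Injective z₀ := by
    refine ⟨fun k => Circle.exp (1 / ((k : ℕ) + 1 : ℝ)), fun k l hkl => ?_⟩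
    have harg : ∀ k : ℕ, Complex.arg (Circle.exp (1 / ((k : ℕ) + 1 : ℝ)) : Circle) =
        1 / ((k : ℕ) + 1 : ℝ) := fun k => by
      have h1 : (0 : ℝ) < 1 / ((k : ℕ) + 1 : ℝ) := by positivity
      have h2 : 1 / ((k : ℕ) + 1 : ℝ) ≤ 1 := by
        rw [div_le_one (by positivity)]; simp
      exact Circle.arg_exp (by linarith [Real.pi_pos]) (by linarith [Real.pi_gt_three])
    have h := congrArg (fun z : Circle => Complex.arg z) hkl
    simp only [harg] at h
    have h3 : ((k : ℕ) : ℝ) = (l : ℕ) := by simpa using h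
    exact Fin.ext (by exact_mod_cast h3)
  obtain ⟨T, hT⟩ := exists_diagonalization_of_injective (φ (X z₀)) (fun i => γ (z₀ i))
    (hγi.comp hz₀) fun i => by rw [hXspec]; exact ⟨i, rfl⟩
  set ψ : (Fin n → Circle) → Fin n → ℂ := fun z i => (T⁻¹.1 * φ (X z) * T.1) i i with hψ
  have hdiag : ∀ z, T⁻¹.1 * φ (X z) * T.1 = diagonal (ψ z) := by
    intro z
    refine eq_diagonal_of_commute (hγi.comp hz₀) ?_
    have h1 : diagonal (γ ∘ z₀) = T⁻¹.1 * φ (X z₀) * T.1 := by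
      rw [hT]; simp [mul_assoc, Function.comp_def]
    rw [h1]
    have h2 := (hXcomm z₀ z).eq
    change T⁻¹.1 * φ (X z₀) * T.1 * (T⁻¹.1 * φ (X z) * T.1) =
      T⁻¹.1 * φ (X z) * T.1 * (T⁻¹.1 * φ (X z₀) * T.1)
    simp only [mul_assoc, Units.mul_inv_cancel_left]
    rw [← mul_assoc (φ (X z₀)), h2, mul_assoc]
  have hφ : ∀ z, φ (X z) = T.1 * diagonal (ψ z) * T⁻¹.1 := by
    intro z
    rw [← hdiag]; simp [mul_assoc]
  have hψc : Continuous ψ := by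
    refine continuous_pi fun i => ?_
    exact (((continuous_const.mul (hc.comp hXc)).mul continuous_const).matrix_elem i i)
  have hmem : ∀ z i, ∃ k, ψ z i = γ (z k) := by
    intro z i
    have h1 : ψ z i ∈ spectrum ℂ (φ (X z)) := by
      rw [hφ, spectrum.units_conjugate, spectrum_diagonal]
      exact ⟨i, rfl⟩
    rw [hXspec] at h1
    obtain ⟨k, hk⟩ := h1
    exact ⟨k, hk.symm⟩
  have h₀ : ∀ i, ψ z₀ i = γ (z₀ i) := by
    intro i
    simp only [hψ]
    rw [hT]
    simp [mul_assoc]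
  have key := eq_of_continuous_selection hγ hγi hψc hmem hz₀ h₀
  refine ⟨T, fun d hd => ?_⟩
  have hz : d = fun i => γ (e ⟨d i, hd i⟩) := by
    funext i; simp [hγdef]
  have h1 : (⟨U * diagonal d * star U, mem_normalMatrices_of_unitary hU hd⟩ : normalMatrices n Λ)
      = X fun i => e ⟨d i, hd i⟩ := by
    apply Subtype.ext
    change U * diagonal d * star U = U * diagonal _ * star U
    rw [← hz]
  rw [h1, hφ]
  congr 3
  funext i
  rw [key, ← congrFun hz i]

/-! ### Frame maps and their nondegeneracy -/

/-- A continuous map from the lines of `ℂⁿ` (given by nonzero spanning vectors) to `n × n`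
matrices, sending each orthogonal frame to the diagonal idempotents `T E₁₁ T⁻¹, …, T Eₙₙ T⁻¹`
with respect to some basis, depending on the frame. The value at the vector `0` is
unconstrained. -/
structure IsFrameMap {n : ℕ} (Q : (Fin n → ℂ) → Matrix (Fin n) (Fin n) ℂ) : Prop where
  continuousOn : ContinuousOn Q {0}ᶜ
  smul : ∀ c : ℂ, c ≠ 0 → ∀ v, Q (c • v) = Q v
  frame : ∀ v : Fin n → Fin n → ℂ, (∀ i, v i ≠ 0) →
    (Pairwise fun i j => star (v i) ⬝ᵥ v j = 0) →
    ∃ T : (Matrix (Fin n) (Fin n) ℂ)ˣ, ∀ i, Q (v i) = T.1 * single i i 1 * T⁻¹.1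

lemma mul_single_mul_apply {n : ℕ} (A B : Matrix (Fin n) (Fin n) ℂ) (m i j : Fin n) :
    (A * single m m (1 : ℂ) * B : Matrix (Fin n) (Fin n) ℂ) i j = A i m * B m j := by
  rw [mul_apply, Finset.sum_eq_single m]
  · simp
  · intro k _ hk
    rw [mul_single_apply_of_ne _ _ _ _ _ hk, zero_mul]
  · simp

namespace IsFrameMap

variable {n : ℕ} {Q : (Fin n → ℂ) → Matrix (Fin n) (Fin n) ℂ}

lemma conj (hQ : IsFrameMap Q) (S : (Matrix (Fin n) (Fin n) ℂ)ˣ) :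
    IsFrameMap fun v => S⁻¹.1 * Q v * S.1 where
  continuousOn := (continuousOn_const.mul hQ.continuousOn).mul continuousOn_const
  smul c hc v := by rw [hQ.smul c hc]
  frame v hv ho := by
    obtain ⟨T, hT⟩ := hQ.frame v hv ho
    refine ⟨S⁻¹ * T, fun i => ?_⟩
    simp [hT, mul_assoc]

lemma transpose (hQ : IsFrameMap Q) : IsFrameMap fun v => (Q v)ᵀ where
  continuousOn := (continuous_id.matrix_transpose).comp_continuousOn hQ.continuousOn
  smul c hc v := by rw [hQ.smul c hc]
  frame v hv ho := by
    obtain ⟨T, hT⟩ := hQ.frame v hv ho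
    refine ⟨⟨T⁻¹.1ᵀ, T.1ᵀ, ?_, ?_⟩, fun i => ?_⟩
    · rw [← transpose_mul, ← Units.val_mul, mul_inv_cancel, Units.val_one, transpose_one]
    · rw [← transpose_mul, ← Units.val_mul, inv_mul_cancel, Units.val_one, transpose_one]
    · rw [hT]
      simp [mul_assoc]

lemma mul_eq_zero_of_orthogonal (hQ : IsFrameMap Q) (hn : 3 ≤ n) {v w : Fin n → ℂ} (hv : v ≠ 0)
    (hw : w ≠ 0) (h : star v ⬝ᵥ w = 0) : Q v * Q w = 0 := by
  have hij : (⟨0, by omega⟩ : Fin n) ≠ ⟨1, by omega⟩ := by simp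
  obtain ⟨u, hu0, hu1, hu, ho⟩ := exists_orthogonal_extension hv hw h hij
  obtain ⟨T, hT⟩ := hQ.frame u hu ho
  have h0 := hT ⟨0, by omega⟩
  have h1 := hT ⟨1, by omega⟩
  rw [hu0] at h0
  rw [hu1] at h1
  rw [h0, h1]
  have : single (⟨0, by omega⟩ : Fin n) (⟨0, by omega⟩ : Fin n) (1 : ℂ) *
      single (⟨1, by omega⟩ : Fin n) (⟨1, by omega⟩ : Fin n) 1 = 0 :=
    single_mul_single_of_ne _ _ _ _ hij _
  simp only [mul_assoc, Units.inv_mul_cancel_left]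
  rw [← mul_assoc (single _ _ _), this, zero_mul, mul_zero]

lemma exists_eq_conj_single (hQ : IsFrameMap Q) (hn : 3 ≤ n) {v : Fin n → ℂ} (hv : v ≠ 0) :
    ∃ (T : (Matrix (Fin n) (Fin n) ℂ)ˣ) (i : Fin n), Q v = T.1 * single i i 1 * T⁻¹.1 := by
  obtain ⟨u, i, hui, hu, ho⟩ := exists_orthogonal_frame hn hv
  obtain ⟨T, hT⟩ := hQ.frame u hu ho
  exact ⟨T, i, hui ▸ hT i⟩

/-- The values of a frame map have rank at most one. -/
lemma minor_eq (hQ : IsFrameMap Q) (hn : 3 ≤ n) {v : Fin n → ℂ} (hv : v ≠ 0)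
    (i j k l : Fin n) : Q v i k * Q v j l = Q v i l * Q v j k := by
  obtain ⟨T, m, hT⟩ := hQ.exists_eq_conj_single hn hv
  simp only [hT, mul_single_mul_apply]
  ring

lemma trace_eq_one (hQ : IsFrameMap Q) (hn : 3 ≤ n) {v : Fin n → ℂ} (hv : v ≠ 0) :
    ∑ i, Q v i i = 1 := by
  obtain ⟨T, m, hT⟩ := hQ.exists_eq_conj_single hn hv
  have : trace (Q v) = 1 := by
    rw [hT, trace_mul_comm, ← mul_assoc, ← Units.val_mul, inv_mul_cancel, Units.val_one, one_mul,
      trace_single_eq_same]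
  exact this

lemma sum_eq_one (hQ : IsFrameMap Q) {v : Fin n → Fin n → ℂ} (hv : ∀ i, v i ≠ 0)
    (ho : Pairwise fun i j => star (v i) ⬝ᵥ v j = 0) : ∑ i, Q (v i) = 1 := by
  obtain ⟨T, hT⟩ := hQ.frame v hv ho
  have h1 : ∑ i : Fin n, single i i (1 : ℂ) = 1 := sum_single_one
  simp only [hT]
  rw [← Finset.sum_mul, ← Finset.mul_sum, h1, mul_one, ← Units.val_mul, mul_inv_cancel,
    Units.val_one]

end IsFrameMap

/-- A frame map sending the standard frame to the standard diagonal idempotents. -/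
structure IsStandardFrameMap {n : ℕ} (Q : (Fin n → ℂ) → Matrix (Fin n) (Fin n) ℂ) : Prop
    extends IsFrameMap Q where
  apply_single : ∀ i, Q (Pi.single i 1) = single i i 1

lemma exists_ne_ne {n : ℕ} (hn : 3 ≤ n) (i j : Fin n) : ∃ k, k ≠ i ∧ k ≠ j := by
  have h : ({i, j} : Finset (Fin n)).card < (Finset.univ : Finset (Fin n)).card := by
    rw [Finset.card_univ, Fintype.card_fin]
    exact lt_of_le_of_lt Finset.card_le_two (by omega)
  obtain ⟨k, -, hk⟩ := Finset.exists_mem_notMem_of_card_lt_card h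
  exact ⟨k, by simpa using hk⟩

/-- The vector `a eᵢ + b eⱼ`. -/
def planeVec {n : ℕ} (i j : Fin n) (a b : ℂ) : Fin n → ℂ := Pi.single i a + Pi.single j b

section planeVec

variable {n : ℕ} {i j : Fin n}

lemma planeVec_left (hij : i ≠ j) (a b : ℂ) : planeVec i j a b i = a := by
  simp [planeVec, hij]

lemma planeVec_right (hij : i ≠ j) (a b : ℂ) : planeVec i j a b j = b := by
  simp [planeVec, hij.symm]

lemma planeVec_of_ne {k : Fin n} (hi : k ≠ i) (hj : k ≠ j) (a b : ℂ) :
    planeVec i j a b k = 0 := by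
  simp [planeVec, hi, hj]

lemma planeVec_comm (i j : Fin n) (a b : ℂ) : planeVec i j a b = planeVec j i b a :=
  add_comm _ _

lemma smul_planeVec (c a b : ℂ) : c • planeVec i j a b = planeVec i j (c * a) (c * b) := by
  simp [planeVec, ← Pi.single_smul]

lemma planeVec_ne_zero_left (hij : i ≠ j) {a : ℂ} (ha : a ≠ 0) (b : ℂ) :
    planeVec i j a b ≠ 0 := fun h => ha (by rw [← planeVec_left hij a b, h]; rfl)

lemma planeVec_ne_zero_right (hij : i ≠ j) (a : ℂ) {b : ℂ} (hb : b ≠ 0) :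
    planeVec i j a b ≠ 0 := fun h => hb (by rw [← planeVec_right hij a b, h]; rfl)

lemma star_planeVec_dotProduct (a b : ℂ) (v : Fin n → ℂ) :
    star (planeVec i j a b) ⬝ᵥ v = star a * v i + star b * v j := by
  simp [planeVec, add_dotProduct]

lemma continuous_planeVec (i j : Fin n) (a : ℂ) : Continuous fun s => planeVec i j a s :=
  continuous_const.add (continuous_single (A := fun _ => ℂ) j)

end planeVec

namespace IsStandardFrameMap

variable {n : ℕ} {Q : (Fin n → ℂ) → Matrix (Fin n) (Fin n) ℂ} {i j k : Fin n}

lemma transpose (hQ : IsStandardFrameMap Q) : IsStandardFrameMap fun v => (Q v)ᵀ where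
  toIsFrameMap := hQ.toIsFrameMap.transpose
  apply_single i := by simp [hQ.apply_single]

/-- The two lines of an orthogonal frame of a coordinate plane are sent to idempotents with
sum `Eᵢᵢ + Eⱼⱼ`. -/
lemma plane_sum (hQ : IsStandardFrameMap Q) (hij : i ≠ j) {a b : ℂ} (hab : a ≠ 0 ∨ b ≠ 0) :
    Q (planeVec i j a b) + Q (planeVec i j (-star b) (star a)) = single i i 1 + single j j 1 := by
  set p := planeVec i j a b with hp
  set q := planeVec i j (-star b) (star a) with hq
  set v : Fin n → Fin n → ℂ := fun k => if k = i then p else if k = j then q else Pi.single k 1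
    with hv
  have hvi : v i = p := by simp [hv]
  have hvj : v j = q := by simp [hv, hij.symm]
  have hvk : ∀ k, k ≠ i → k ≠ j → v k = Pi.single k 1 := fun k h1 h2 => by simp [hv, h1, h2]
  have hv0 : ∀ k, v k ≠ 0 := by
    intro k
    by_cases h1 : k = i
    · subst h1
      rw [hvi]
      rcases hab with h | h
      · exact planeVec_ne_zero_left hij h b
      · exact planeVec_ne_zero_right hij a h
    by_cases h2 : k = j
    · subst h2
      rw [hvj]
      rcases hab with h | h
      · exact planeVec_ne_zero_right hij _ (star_ne_zero.2 h)
      · exact planeVec_ne_zero_left hij (neg_ne_zero.2 (star_ne_zero.2 h)) _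
    · rw [hvk k h1 h2]; simp
  have hlt : ∀ k l, k ≠ l → k = i ∨ (k = j ∧ l ≠ i) ∨ (k ≠ i ∧ k ≠ j ∧ l ≠ i ∧ l ≠ j) →
      star (v k) ⬝ᵥ v l = 0 := by
    rintro k l hkl (rfl | ⟨rfl, hl⟩ | ⟨h1, h2, h3, h4⟩)
    · rw [hvi, hp, star_planeVec_dotProduct]
      by_cases h2 : l = j
      · subst h2
        rw [hvj, hq, planeVec_left hij, planeVec_right hij]
        ring
      · rw [hvk l hkl.symm h2]
        simp [hkl, Ne.symm h2]
    · rw [hvj, hq, star_planeVec_dotProduct, hvk l hl hkl.symm]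
      simp [hl.symm, hkl]
    · rw [hvk k h1 h2, hvk l h3 h4]
      simp [hkl]
  have ho : Pairwise fun k l => star (v k) ⬝ᵥ v l = 0 := by
    intro k l hkl
    have hsymm : star (v l) ⬝ᵥ v k = 0 → star (v k) ⬝ᵥ v l = 0 := fun h => by
      rw [star_dotProduct, h, star_zero]
    by_cases h1 : k = i
    · exact hlt k l hkl (Or.inl h1)
    by_cases h2 : l = i
    · exact hsymm (hlt l k hkl.symm (Or.inl h2))
    by_cases h3 : k = j
    · exact hlt k l hkl (Or.inr (Or.inl ⟨h3, h2⟩))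
    by_cases h4 : l = j
    · exact hsymm (hlt l k hkl.symm (Or.inr (Or.inl ⟨h4, h1⟩)))
    · exact hlt k l hkl (Or.inr (Or.inr ⟨h1, h3, h2, h4⟩))
  have h1 := hQ.sum_eq_one hv0 ho
  have h2 : ∑ k : Fin n, single k k (1 : ℂ) = 1 := sum_single_one
  have h3 : ∑ k, (Q (v k) - single k k 1) = 0 := by
    rw [Finset.sum_sub_distrib, h1, h2, sub_self]
  rw [Finset.sum_eq_add i j hij (fun k _ hk => by
    rw [hvk k hk.1 hk.2, hQ.apply_single, sub_self]) (by simp) (by simp), hvi, hvj] at h3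
  rw [← sub_eq_zero, ← h3]
  abel

/-- Compressing `Q v` to a coordinate plane: rows `i` and `j` of `Q v` are proportional to those
of `Q p`, where `p` is the projection of `v` to the plane spanned by `eᵢ` and `eⱼ`. Indeed the
vector `q` orthogonal to `p` in the plane is orthogonal to `v`, so `Q q * Q v = 0`. -/
lemma row_proportional (hQ : IsStandardFrameMap Q) (hn : 3 ≤ n) (hij : i ≠ j) {v : Fin n → ℂ}
    (hv : v i ≠ 0 ∨ v j ≠ 0) (k l : Fin n) :
    Q v i k * Q (planeVec i j (v i) (v j)) j l = Q v j k * Q (planeVec i j (v i) (v j)) i l := by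
  have hv0 : v ≠ 0 := by rintro rfl; simp at hv
  set p := planeVec i j (v i) (v j) with hp
  set q := planeVec i j (-star (v j)) (star (v i)) with hq
  have hp0 : p ≠ 0 := by
    rcases hv with h | h
    · exact planeVec_ne_zero_left hij h _
    · exact planeVec_ne_zero_right hij _ h
  have hq0 : q ≠ 0 := by
    rcases hv with h | h
    · exact planeVec_ne_zero_right hij _ (star_ne_zero.2 h)
    · exact planeVec_ne_zero_left hij (neg_ne_zero.2 (star_ne_zero.2 h)) _
  have hqv : Q q * Q v = 0 := by
    refine hQ.mul_eq_zero_of_orthogonal hn hq0 hv0 ?_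
    rw [hq, star_planeVec_dotProduct]
    simp
    ring
  have hsum := hQ.plane_sum hij hv
  have hK : (single i i 1 + single j j 1) * Q v = Q p * Q v := by
    rw [← hsum, add_mul, hqv, add_zero]
  have hi : Q v i k = ∑ m, Q p i m * Q v m k := by
    rw [← mul_apply, ← hK]
    simp [add_mul, hij]
  have hj : Q v j k = ∑ m, Q p j m * Q v m k := by
    rw [← mul_apply, ← hK]
    simp [add_mul, hij.symm]
  rw [hi, hj, Finset.sum_mul, Finset.sum_mul]
  refine Finset.sum_congr rfl fun m _ => ?_
  linear_combination Q v m k * hQ.minor_eq hn hp0 i j m l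

lemma apply_planeVec_zero (hQ : IsStandardFrameMap Q) {a : ℂ} (ha : a ≠ 0) :
    Q (planeVec i j a 0) = single i i 1 := by
  have : planeVec i j a 0 = a • Pi.single i 1 := by
    simp [planeVec, ← Pi.single_smul]
  rw [this, hQ.smul a ha, hQ.apply_single]

lemma row_eq_zero (hQ : IsStandardFrameMap Q) (hn : 3 ≤ n) {v : Fin n → ℂ} (hv : v ≠ 0)
    (hj : v j = 0) (k : Fin n) : Q v j k = 0 := by
  obtain ⟨i, hi⟩ : ∃ i, v i ≠ 0 := Function.ne_iff.1 hv
  have hij : i ≠ j := by rintro rfl; exact hi hj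
  have h := hQ.row_proportional hn hij (Or.inl hi) k i
  rw [hj, hQ.apply_planeVec_zero hi] at h
  simpa [hij] using h.symm

lemma exists_row_ne_zero (hQ : IsStandardFrameMap Q) (hn : 3 ≤ n) {v : Fin n → ℂ} (hv : v ≠ 0) :
    ∃ i, Q v i ≠ 0 := by
  by_contra! h
  have := hQ.trace_eq_one hn hv
  simp [h] at this

end IsStandardFrameMap

/-- Neither of the rows `i` and `j` of `Q (a eᵢ + b eⱼ)` vanishes: in terms of the range of this
idempotent, the line spanned by `a eᵢ + b eⱼ` is not sent to a coordinate axis. -/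
def IsNondegenerate {n : ℕ} (Q : (Fin n → ℂ) → Matrix (Fin n) (Fin n) ℂ) (i j : Fin n)
    (a b : ℂ) : Prop :=
  Q (planeVec i j a b) i ≠ 0 ∧ Q (planeVec i j a b) j ≠ 0

namespace IsStandardFrameMap

variable {n : ℕ} {Q : (Fin n → ℂ) → Matrix (Fin n) (Fin n) ℂ} {i j k : Fin n}

lemma nondegenerate_comm {a b : ℂ} (h : IsNondegenerate Q i j a b) :
    IsNondegenerate Q j i b a := by
  unfold IsNondegenerate at *
  rw [planeVec_comm]
  exact h.symm

lemma nondegenerate_smul (hQ : IsStandardFrameMap Q) {a b c : ℂ} (hc : c ≠ 0) :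
    IsNondegenerate Q i j (c * a) (c * b) ↔ IsNondegenerate Q i j a b := by
  unfold IsNondegenerate
  rw [← smul_planeVec, hQ.smul c hc]

lemma row_ne_zero_of_nondegenerate (hQ : IsStandardFrameMap Q) (hn : 3 ≤ n) (hij : i ≠ j)
    {v : Fin n → ℂ} (hv : v i ≠ 0) (h : IsNondegenerate Q i j (v i) (v j)) (hi : Q v i ≠ 0) :
    Q v j ≠ 0 := by
  obtain ⟨k, hk⟩ := Function.ne_iff.1 hi
  obtain ⟨l, hl⟩ := Function.ne_iff.1 h.2
  have := hQ.row_proportional hn hij (Or.inl hv) k l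
  intro h0
  rw [h0] at this
  simp_all

lemma nondegenerate_of_row_ne_zero (hQ : IsStandardFrameMap Q) (hn : 3 ≤ n) (hij : i ≠ j)
    {v : Fin n → ℂ} (hv : v i ≠ 0) (hi : Q v i ≠ 0) (hj : Q v j ≠ 0) :
    IsNondegenerate Q i j (v i) (v j) := by
  obtain ⟨k, hk⟩ := Function.ne_iff.1 hi
  obtain ⟨l, hl⟩ := Function.ne_iff.1 hj
  have hp := planeVec_ne_zero_left hij hv (v j)
  obtain ⟨m, hm⟩ := hQ.exists_row_ne_zero hn hp
  have hmij : m = i ∨ m = j := by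
    by_contra! h
    exact hm (funext fun x => hQ.row_eq_zero hn hp (planeVec_of_ne h.1 h.2 _ _) x)
  obtain ⟨x, hx⟩ := Function.ne_iff.1 hm
  have h1 := hQ.row_proportional hn hij (Or.inl hv) k x
  have h2 := hQ.row_proportional hn hij (Or.inl hv) l x
  rcases hmij with rfl | rfl
  · refine ⟨hm, fun h0 => ?_⟩
    rw [h0] at h2
    simp_all
  · refine ⟨fun h0 => ?_, hm⟩
    rw [h0] at h1
    simp_all

/-- Nondegeneracy is transitive: at a vector supported on three coordinates, either all of the three
rows vanish or none does. -/
lemma nondegenerate_trans (hQ : IsStandardFrameMap Q) (hn : 3 ≤ n) (hij : i ≠ j) (hjk : j ≠ k)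
    (hik : i ≠ k) {a b c : ℂ} (ha : a ≠ 0) (hb : b ≠ 0) (hc : c ≠ 0)
    (h1 : IsNondegenerate Q i j a b) (h2 : IsNondegenerate Q j k b c) :
    IsNondegenerate Q i k a c := by
  set v : Fin n → ℂ := Pi.single i a + Pi.single j b + Pi.single k c with hv
  have hvi : v i = a := by simp [hv, hij, hik]
  have hvj : v j = b := by simp [hv, hij.symm, hjk]
  have hvk : v k = c := by simp [hv, hik.symm, hjk.symm]
  have hv0 : v ≠ 0 := fun h => ha (by rw [← hvi, h]; rfl)
  obtain ⟨m, hm⟩ := hQ.exists_row_ne_zero hn hv0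
  have hm' : m = i ∨ m = j ∨ m = k := by
    by_contra! h
    exact hm (funext fun x => hQ.row_eq_zero hn hv0 (by simp [hv, h]) x)
  have hj : Q v j ≠ 0 := by
    rcases hm' with rfl | rfl | rfl
    · exact hQ.row_ne_zero_of_nondegenerate hn hij (by rwa [hvi]) (by rwa [hvi, hvj]) hm
    · exact hm
    · exact hQ.row_ne_zero_of_nondegenerate hn hjk.symm (by rwa [hvk])
        (by rw [hvk, hvj]; exact nondegenerate_comm h2) hm
  have hi : Q v i ≠ 0 := hQ.row_ne_zero_of_nondegenerate hn hij.symm (by rwa [hvj])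
    (by rw [hvi, hvj]; exact nondegenerate_comm h1) hj
  have hk : Q v k ≠ 0 := hQ.row_ne_zero_of_nondegenerate hn hjk (by rwa [hvj])
    (by rwa [hvj, hvk]) hj
  have := hQ.nondegenerate_of_row_ne_zero hn hik (by rwa [hvi]) hi hk
  rwa [hvi, hvk] at this

lemma continuous_apply_planeVec (hQ : IsStandardFrameMap Q) (hij : i ≠ j) :
    Continuous fun s => Q (planeVec i j 1 s) :=
  hQ.continuousOn.comp_continuous (continuous_planeVec i j 1)
    fun s => planeVec_ne_zero_left hij one_ne_zero s

lemma isOpen_setOf_nondegenerate (hQ : IsStandardFrameMap Q) (hij : i ≠ j) :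
    IsOpen {s : ℂ | IsNondegenerate Q i j 1 (Complex.exp s)} := by
  have hc := (hQ.continuous_apply_planeVec hij).comp Complex.continuous_exp
  have hr : ∀ m, IsOpen {s : ℂ | Q (planeVec i j 1 (Complex.exp s)) m ≠ 0} := fun m =>
    isOpen_ne_fun ((continuous_apply m).comp hc) continuous_const
  exact (hr i).inter (hr j)

/-- Some line in the plane of `eᵢ` and `eⱼ` is nondegenerate: otherwise the lines other than the
axes would be split into two disjoint closed sets, according to the row that vanishes. Both
sets are nonempty, by continuity at the axes. -/
lemma exists_nondegenerate (hQ : IsStandardFrameMap Q) (hn : 3 ≤ n) (hij : i ≠ j) :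
    ∃ s : ℂ, IsNondegenerate Q i j 1 (Complex.exp s) := by
  by_contra! hcon
  have hc := (hQ.continuous_apply_planeVec hij).comp Complex.continuous_exp
  set Z : Fin n → Set ℂ := fun m => {s : ℂ | Q (planeVec i j 1 (Complex.exp s)) m = 0} with hZ
  have hZc : ∀ m, IsClosed (Z m) := fun m =>
    isClosed_eq ((continuous_apply m).comp hc) continuous_const
  have hnear : ∀ i j : Fin n, i ≠ j → ∃ w : ℂ, w ≠ 0 ∧ Q (planeVec i j 1 w) i ≠ 0 := by
    intro i j hij
    have h0 : {w : ℂ | Q (planeVec i j 1 w) i ≠ 0} ∈ nhds (0 : ℂ) := by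
      refine (isOpen_ne_fun ((continuous_apply i).comp (hQ.continuous_apply_planeVec hij))
        continuous_const).mem_nhds ?_
      intro h
      have h' : Q (planeVec i j 1 0) i i = 0 := congrFun h i
      simp [hQ.apply_planeVec_zero] at h'
    have h1 := Filter.Eventually.and (nhdsWithin_le_nhds h0 : _ ∈ nhdsWithin (0 : ℂ) {0}ᶜ)
      self_mem_nhdsWithin
    obtain ⟨w, hw, hw0⟩ := h1.exists
    exact ⟨w, hw0, hw⟩
  have hcover : Set.univ ⊆ Z i ∪ Z j := by
    intro s _
    by_contra h
    simp only [Set.mem_union, not_or] at h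
    exact hcon s h
  have hdisj : Set.univ ∩ (Z i ∩ Z j) = ∅ := by
    rw [Set.eq_empty_iff_forall_notMem]
    rintro s ⟨-, h1, h2⟩
    have hp := planeVec_ne_zero_left hij one_ne_zero (Complex.exp s)
    obtain ⟨m, hm⟩ := hQ.exists_row_ne_zero hn hp
    by_cases hmi : m = i
    · subst hmi; exact hm h1
    by_cases hmj : m = j
    · subst hmj; exact hm h2
    exact hm (funext fun x => hQ.row_eq_zero hn hp (planeVec_of_ne hmi hmj _ _) x)
  rcases isPreconnected_iff_subset_of_disjoint_closed.1 (isPreconnected_univ (α := ℂ)) _ _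
    (hZc i) (hZc j) hcover hdisj with h | h
  · obtain ⟨w, hw0, hw⟩ := hnear i j hij
    have := h (Set.mem_univ (Complex.log w))
    simp only [hZ, Set.mem_ofPred_eq, Complex.exp_log hw0] at this
    exact hw this
  · obtain ⟨w, hw0, hw⟩ := hnear j i hij.symm
    have := h (Set.mem_univ (Complex.log w⁻¹))
    simp only [hZ, Set.mem_ofPred_eq, Complex.exp_log (inv_ne_zero hw0)] at this
    rw [planeVec_comm, ← hQ.smul w hw0, smul_planeVec, mul_inv_cancel₀ hw0, mul_one,
      planeVec_comm, planeVec_comm] at this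
    exact hw this

/-- All lines of a coordinate plane other than the axes are nondegenerate: in logarithmic
coordinates the nondegenerate ones form a coset of an open subgroup of `ℂ`, as the third
coordinate allows to compose their slopes. -/
lemma nondegenerate (hQ : IsStandardFrameMap Q) (hn : 3 ≤ n) (hij : i ≠ j) {a b : ℂ}
    (ha : a ≠ 0) (hb : b ≠ 0) : IsNondegenerate Q i j a b := by
  obtain ⟨k, hki, hkj⟩ := exists_ne_ne hn i j
  set A : Fin n → Fin n → Set ℂ := fun i j => {s : ℂ | IsNondegenerate Q i j 1 (Complex.exp s)}
    with hA
  have hexp := Complex.exp_ne_zero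
  have hiff : ∀ i j : Fin n, ∀ s t : ℂ,
      IsNondegenerate Q i j (Complex.exp s) (Complex.exp t) ↔ t - s ∈ A i j := by
    intro i j s t
    change _ ↔ IsNondegenerate Q i j 1 (Complex.exp (t - s))
    rw [← hQ.nondegenerate_smul (hexp s) (a := 1), mul_one, ← Complex.exp_add, add_sub_cancel]
  have htrans : ∀ i j k : Fin n, i ≠ j → j ≠ k → i ≠ k → ∀ s t : ℂ, s ∈ A i j → t ∈ A j k →
      s + t ∈ A i k := by
    intro i j k hij hjk hik s t hs ht
    have h1 := (hiff i j 0 s).2 (by simpa using hs)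
    have h2 := (hiff j k s (s + t)).2 (by simpa using ht)
    have := hQ.nondegenerate_trans hn hij hjk hik (hexp _) (hexp _) (hexp _) h1 h2
    simpa using (hiff i k 0 (s + t)).1 this
  have hneg : ∀ i j : Fin n, ∀ s, s ∈ A i j → -s ∈ A j i := by
    intro i j s hs
    have := nondegenerate_comm ((hiff i j 0 s).2 (by simpa using hs))
    simpa using (hiff j i s 0).1 this
  obtain ⟨y, hy⟩ := hQ.exists_nondegenerate hn hkj.symm
  -- `A i j` is a coset of a subgroup; the detour through `k` composes slopes
  have htern : ∀ s t u : ℂ, s ∈ A i j → t ∈ A i j → u ∈ A i j → s + t - u ∈ A i j := by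
    intro s t u hs ht hu
    have h1 : t + y ∈ A i k := htrans i j k hij hkj.symm hki.symm t y ht hy
    have h2 : -u + (t + y) ∈ A j k := htrans j i k hij.symm hki.symm hkj.symm _ _ (hneg _ _ _ hu) h1
    have h3 : s + (-u + (t + y)) ∈ A i k := htrans i j k hij hkj.symm hki.symm _ _ hs h2
    have h4 := htrans i k j hki.symm hkj hij _ _ h3 (hneg _ _ _ hy)
    convert h4 using 1
    ring
  obtain ⟨x, hx⟩ := hQ.exists_nondegenerate hn hij
  have hopen : IsOpen (A i j) := hQ.isOpen_setOf_nondegenerate hij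
  have hclosed : IsClosed (A i j) := by
    rw [← isOpen_compl_iff, isOpen_iff_mem_nhds]
    intro z hz
    have h1 : Filter.Tendsto (fun w => x + (w - z)) (nhds z) (nhds x) := by
      have : Continuous fun w : ℂ => x + (w - z) := by fun_prop
      simpa using this.tendsto z
    filter_upwards [h1 (hopen.mem_nhds hx)] with w hw hwA
    refine hz ?_
    have := htern w x _ hwA hx hw
    rwa [show w + x - (x + (w - z)) = z by ring] at this
  have huniv : A i j = Set.univ := IsClopen.eq_univ ⟨hclosed, hopen⟩ ⟨x, hx⟩
  have := (hiff i j (Complex.log a) (Complex.log b)).2 (by rw [huniv]; trivial)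
  rwa [Complex.exp_log ha, Complex.exp_log hb] at this

lemma row_ne_zero (hQ : IsStandardFrameMap Q) (hn : 3 ≤ n) {v : Fin n → ℂ} (hi : v i ≠ 0) :
    Q v i ≠ 0 := by
  have hv : v ≠ 0 := fun h => hi (by rw [h]; rfl)
  obtain ⟨j, hj⟩ := hQ.exists_row_ne_zero hn hv
  by_cases hij : j = i
  · exact hij ▸ hj
  have hvj : v j ≠ 0 := fun h => hj (funext fun x => hQ.row_eq_zero hn hv h x)
  exact hQ.row_ne_zero_of_nondegenerate hn hij hvj (hQ.nondegenerate hn hij hvj hi) hj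

/-- The rows and, by transposition, the columns of `Q v` that belong to nonzero coordinates of `v`
do not vanish; as the rank is one, neither do the entries where they meet. -/
lemma entry_ne_zero (hQ : IsStandardFrameMap Q) (hn : 3 ≤ n) {v : Fin n → ℂ} (hi : v i ≠ 0)
    (hj : v j ≠ 0) : Q v i j ≠ 0 := by
  have hv : v ≠ 0 := fun h => hi (by rw [h]; rfl)
  obtain ⟨k, hk⟩ := Function.ne_iff.1 (hQ.row_ne_zero hn hi)
  obtain ⟨l, hl⟩ := Function.ne_iff.1 (hQ.transpose.row_ne_zero hn hj)
  have h := hQ.minor_eq hn hv i l k j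
  intro h0
  rw [h0, zero_mul] at h
  exact mul_ne_zero hk hl h

end IsStandardFrameMap

/-! ### Coordinatisation of frame maps -/

/-- The slope of the range of the idempotent `Q (eᵢ + s eⱼ)`, computed from the `i`-th column of that
matrix; it is meaningful when the diagonal entry in the denominator is nonzero. -/
noncomputable def rangeSlope {n : ℕ} (Q : (Fin n → ℂ) → Matrix (Fin n) (Fin n) ℂ) (i j : Fin n)
    (s : ℂ) : ℂ :=
  Q (planeVec i j 1 s) j i / Q (planeVec i j 1 s) i i

namespace IsStandardFrameMap

variable {n : ℕ} {Q : (Fin n → ℂ) → Matrix (Fin n) (Fin n) ℂ} {i j k : Fin n}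

lemma apply_planeVec_ne_zero (hQ : IsStandardFrameMap Q) (hn : 3 ≤ n) (hij : i ≠ j) (s : ℂ) :
    Q (planeVec i j 1 s) i i ≠ 0 := by
  have h := planeVec_left hij 1 s
  exact hQ.entry_ne_zero hn (by rw [h]; exact one_ne_zero) (by rw [h]; exact one_ne_zero)

/-- The slopes determine the range of every `Q v`. -/
lemma row_eq_slope_mul (hQ : IsStandardFrameMap Q) (hn : 3 ≤ n) (hij : i ≠ j) {v : Fin n → ℂ}
    (hv : v i ≠ 0) (k : Fin n) : Q v j k = rangeSlope Q i j (v j / v i) * Q v i k := by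
  have h := hQ.row_proportional hn hij (Or.inl hv) k i
  have h1 : planeVec i j (v i) (v j) = v i • planeVec i j 1 (v j / v i) := by
    rw [smul_planeVec, mul_one, mul_div_cancel₀ _ hv]
  have h2 := hQ.apply_planeVec_ne_zero hn hij (v j / v i)
  rw [h1, hQ.smul _ hv] at h
  unfold rangeSlope
  field_simp
  linear_combination -h

lemma slope_zero (hQ : IsStandardFrameMap Q) (hij : i ≠ j) : rangeSlope Q i j 0 = 0 := by
  simp [rangeSlope, hQ.apply_planeVec_zero, hij]

lemma continuous_slope (hQ : IsStandardFrameMap Q) (hn : 3 ≤ n) (hij : i ≠ j) :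
    Continuous (rangeSlope Q i j) := by
  have hc := hQ.continuous_apply_planeVec hij
  exact (hc.matrix_elem j i).div (hc.matrix_elem i i) (hQ.apply_planeVec_ne_zero hn hij)

/-- Slopes compose along a triple of coordinates. -/
lemma slope_mul_slope (hQ : IsStandardFrameMap Q) (hn : 3 ≤ n) (hij : i ≠ j) (hjk : j ≠ k)
    (hik : i ≠ k) {s : ℂ} (hs : s ≠ 0) (t : ℂ) :
    rangeSlope Q i k t = rangeSlope Q j k (t / s) * rangeSlope Q i j s := by
  set v : Fin n → ℂ := Pi.single i 1 + Pi.single j s + Pi.single k t with hv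
  have hvi : v i = 1 := by simp [hv, hij, hik]
  have hvj : v j = s := by simp [hv, hij.symm, hjk]
  have hvk : v k = t := by simp [hv, hik.symm, hjk.symm]
  have hi : v i ≠ 0 := by rw [hvi]; exact one_ne_zero
  have h1 := hQ.row_eq_slope_mul hn hik hi i
  have h2 := hQ.row_eq_slope_mul hn hij hi i
  have h3 := hQ.row_eq_slope_mul hn hjk (v := v) (by rwa [hvj]) i
  simp only [hvi, hvj, hvk, div_one] at h1 h2 h3
  rw [h1, h2, ← mul_assoc] at h3
  exact mul_right_cancel₀ (hQ.entry_ne_zero hn hi hi) h3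

/-- If all slopes at `1` are normalised to be `1`, then all slope functions agree. -/
lemma slope_eq_slope (hQ : IsStandardFrameMap Q) (hn : 3 ≤ n)
    (hone : ∀ i j, i ≠ j → rangeSlope Q i j 1 = 1) {k l : Fin n} (hij : i ≠ j) (hkl : k ≠ l) :
    rangeSlope Q i j = rangeSlope Q k l := by
  have hfirst : ∀ a b c : Fin n, a ≠ c → b ≠ c → rangeSlope Q a c = rangeSlope Q b c := by
    intro a b c hac hbc
    by_cases hab : a = b
    · rw [hab]
    funext t
    rw [hQ.slope_mul_slope hn hab hbc hac one_ne_zero, hone a b hab, div_one, mul_one]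
  have hsecond : ∀ a b c : Fin n, a ≠ b → a ≠ c → rangeSlope Q a b = rangeSlope Q a c := by
    intro a b c hab hac
    by_cases hbc : b = c
    · rw [hbc]
    funext t
    by_cases ht : t = 0
    · rw [ht, hQ.slope_zero hab, hQ.slope_zero hac]
    rw [hQ.slope_mul_slope hn hab hbc hac ht, div_self ht, hone b c hbc, one_mul]
  by_cases hkj : k = j
  · by_cases hli : l = i
    · obtain ⟨m, hmi, hmj⟩ := exists_ne_ne hn i j
      rw [hkj, hli, hsecond i j m hij hmi.symm, hfirst i j m hmi.symm hmj.symm,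
        hsecond j m i hmj.symm hij.symm]
    · rw [hsecond i j l hij (Ne.symm hli), hfirst i k l (Ne.symm hli) hkl]
  · rw [hfirst i k j hij hkj, hsecond k j l hkj hkl]

/-- The slopes of the ranges at `s` determine those of the kernels at `-1/s̄`, by
orthogonality. -/
lemma slope_transpose_mul_slope (hQ : IsStandardFrameMap Q) (hn : 3 ≤ n) (hij : i ≠ j) {s : ℂ}
    (hs : s ≠ 0) :
    rangeSlope (fun v => (Q v)ᵀ) i j s * rangeSlope Q i j (-(star s)⁻¹) = -1 := by
  set p := planeVec i j 1 s with hp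
  set q := planeVec i j 1 (-(star s)⁻¹) with hq
  have hp0 : p ≠ 0 := planeVec_ne_zero_left hij one_ne_zero _
  have hq0 : q ≠ 0 := planeVec_ne_zero_left hij one_ne_zero _
  have horth : Q p * Q q = 0 := by
    refine hQ.mul_eq_zero_of_orthogonal hn hp0 hq0 ?_
    have : star s ≠ 0 := star_ne_zero.2 hs
    rw [hp, star_planeVec_dotProduct, hq, planeVec_left hij, planeVec_right hij]
    rw [star_one, mul_neg, mul_inv_cancel₀ this]
    ring
  have h := congrFun (congrFun horth i) i
  rw [mul_apply, Finset.sum_eq_add i j hij (fun m _ hm => by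
    rw [hQ.row_eq_zero hn hq0 (planeVec_of_ne hm.1 hm.2 _ _), mul_zero]) (by simp) (by simp)] at h
  have h1 := hQ.apply_planeVec_ne_zero hn hij s
  have h2 := hQ.apply_planeVec_ne_zero hn hij (-(star s)⁻¹)
  unfold rangeSlope
  simp only [transpose_apply]
  rw [← hp, ← hq]
  rw [← hp] at h1
  rw [← hq] at h2
  field_simp
  rw [Matrix.zero_apply] at h
  linear_combination h

/-- The coordinatisation step: after normalisation, the common slope function is a continuous
field endomorphism of `ℂ`, hence the identity or complex conjugation. -/
lemma slope_eq_id_or_star (hQ : IsStandardFrameMap Q) (hn : 3 ≤ n)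
    (hone : ∀ i j, i ≠ j → rangeSlope Q i j 1 = 1) :
    ∃ g : ℂ → ℂ, (∀ i j, i ≠ j → rangeSlope Q i j = g) ∧
      (∀ i j, i ≠ j → ∀ s, rangeSlope (fun v => (Q v)ᵀ) i j s = g (star s)) ∧
      ((∀ s, g s = s) ∨ ∀ s, g s = star s) := by
  set e₀ : Fin n := ⟨0, by omega⟩
  set e₁ : Fin n := ⟨1, by omega⟩
  set e₂ : Fin n := ⟨2, by omega⟩
  have h01 : e₀ ≠ e₁ := by simp [e₀, e₁]
  have h12 : e₁ ≠ e₂ := by simp [e₁, e₂]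
  have h02 : e₀ ≠ e₂ := by simp [e₀, e₂]
  set g := rangeSlope Q e₀ e₁ with hg
  have hslope : ∀ i j, i ≠ j → rangeSlope Q i j = g := fun i j hij => hQ.slope_eq_slope hn hone hij h01
  have hg0 : g 0 = 0 := hQ.slope_zero h01
  have hg1 : g 1 = 1 := hone _ _ h01
  have hmul : ∀ s t, g (s * t) = g s * g t := by
    intro s t
    by_cases hs : s = 0
    · rw [hs, zero_mul, hg0, zero_mul]
    have := hQ.slope_mul_slope hn h01 h12 h02 hs (s * t)
    rwa [hslope _ _ h02, hslope _ _ h12, mul_div_cancel_left₀ _ hs, mul_comm (g t)] at this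
  have hT : ∀ i j, i ≠ j → ∀ s, rangeSlope (fun v => (Q v)ᵀ) i j s = -g (-star s) := by
    intro i j hij s
    by_cases hs : s = 0
    · rw [hs, hQ.transpose.slope_zero hij]
      simp [hg0]
    have h1 := hQ.slope_transpose_mul_slope hn hij hs
    rw [hslope i j hij] at h1
    have h2 : g (-(star s)⁻¹) * g (-star s) = 1 := by
      rw [← hmul, neg_mul_neg, inv_mul_cancel₀ (star_ne_zero.2 hs), hg1]
    linear_combination g (-star s) * h1 - rangeSlope (fun v => (Q v)ᵀ) i j s * h2
  have hgn : g (-1) = -1 := by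
    have h := hQ.transpose.slope_mul_slope hn h01 h12 h02 one_ne_zero 1
    rw [hT _ _ h01, hT _ _ h02, div_one, hT _ _ h12, star_one] at h
    have h1 : g (-1) * g (-1) = 1 := by rw [← hmul]; simp [hg1]
    linear_combination -h - h1
  have hneg : ∀ s, g (-s) = -g s := fun s => by
    rw [← neg_one_mul, hmul, hgn, neg_one_mul]
  have hT' : ∀ i j, i ≠ j → ∀ s, rangeSlope (fun v => (Q v)ᵀ) i j s = g (star s) := by
    intro i j hij s
    rw [hT i j hij, hneg, neg_neg]
  have hone_add : ∀ a, g (1 + a) = 1 + g a := by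
    intro a
    -- orthogonality of `(1, 1, 1)` and `(1, a, -1 - a)`
    set v : Fin n → ℂ := Pi.single e₀ 1 + Pi.single e₁ 1 + Pi.single e₂ 1 with hv
    set w : Fin n → ℂ := Pi.single e₀ 1 + Pi.single e₁ a + Pi.single e₂ (-1 - a) with hw
    have hv0 : v e₀ = 1 := by simp [hv, h01, h02]
    have hv1 : v e₁ = 1 := by simp [hv, h01.symm, h12]
    have hv2 : v e₂ = 1 := by simp [hv, h02.symm, h12.symm]
    have hw0 : w e₀ = 1 := by simp [hw, h01, h02]
    have hw1 : w e₁ = a := by simp [hw, h01.symm, h12]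
    have hw2 : w e₂ = -1 - a := by simp [hw, h02.symm, h12.symm]
    have hv0' : v e₀ ≠ 0 := by rw [hv0]; exact one_ne_zero
    have hw0' : w e₀ ≠ 0 := by rw [hw0]; exact one_ne_zero
    have hvne : v ≠ 0 := fun h => hv0' (by rw [h]; rfl)
    have hwne : w ≠ 0 := fun h => hw0' (by rw [h]; rfl)
    have horth : Q v * Q w = 0 := by
      refine hQ.mul_eq_zero_of_orthogonal hn hvne hwne ?_
      have : star v = v := by simp [hv]
      rw [this, hv, add_dotProduct, add_dotProduct, single_dotProduct, single_dotProduct,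
        single_dotProduct, hw0, hw1, hw2]
      ring
    have h := congrFun (congrFun horth e₀) e₀
    have hrest : ∀ m, m ≠ e₀ → m ≠ e₁ → m ≠ e₂ → Q v e₀ m * Q w m e₀ = 0 := by
      intro m h0 h1 h2
      rw [hQ.row_eq_zero hn hwne (by simp [hw, h0, h1, h2]), mul_zero]
    rw [mul_apply, ← Finset.sum_subset (Finset.subset_univ {e₀, e₁, e₂}) (fun m _ hm => by
      simp only [Finset.mem_insert, Finset.mem_singleton, not_or] at hm
      exact hrest m hm.1 hm.2.1 hm.2.2), Finset.sum_insert (by simp [h01, h02]),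
      Finset.sum_pair h12] at h
    have r1 := hQ.transpose.row_eq_slope_mul hn h01 hv0' e₀
    have r2 := hQ.transpose.row_eq_slope_mul hn h02 hv0' e₀
    have c1 := hQ.row_eq_slope_mul hn h01 hw0' e₀
    have c2 := hQ.row_eq_slope_mul hn h02 hw0' e₀
    rw [hT' _ _ h01, hv1, hv0, div_one, star_one, hg1, one_mul] at r1
    rw [hT' _ _ h02, hv2, hv0, div_one, star_one, hg1, one_mul] at r2
    rw [hw1, hw0, div_one, hslope _ _ h01] at c1
    rw [hw2, hw0, div_one, hslope _ _ h02] at c2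
    simp only [transpose_apply] at r1 r2
    rw [r1, r2, c1, c2] at h
    have h3 : Q v e₀ e₀ * Q w e₀ e₀ ≠ 0 := mul_ne_zero (hQ.entry_ne_zero hn hv0' hv0')
      (hQ.entry_ne_zero hn hw0' hw0')
    have h4 : Q v e₀ e₀ * Q w e₀ e₀ * (1 + g a + g (-1 - a)) = 0 := by
      rw [Matrix.zero_apply] at h
      linear_combination h
    have h5 := (mul_eq_zero.1 h4).resolve_left h3
    have h6 : g (-1 - a) = -g (1 + a) := by rw [← hneg]; congr 1; ring
    linear_combination h6 - h5
  have hadd : ∀ s t, g (s + t) = g s + g t := by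
    intro s t
    by_cases hs : s = 0
    · rw [hs, zero_add, hg0, zero_add]
    have h1 : s + t = s * (1 + t / s) := by field_simp
    have h2 : t = s * (t / s) := by field_simp
    rw [h1, hmul, hone_add, mul_add, mul_one, ← hmul, ← h2]
  refine ⟨g, hslope, hT', ?_⟩
  let f : ℂ →+* ℂ :=
    { toFun := g, map_one' := hg1, map_mul' := hmul, map_zero' := hg0, map_add' := hadd }
  rcases Complex.ringHom_eq_id_or_conj_of_continuous (f := f) (hQ.continuous_slope hn h01) with
    h | h
  · exact Or.inl fun s => congrArg (fun F : ℂ →+* ℂ => F s) h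
  · exact Or.inr fun s => congrArg (fun F : ℂ →+* ℂ => F s) h

/-- A normalised frame map is the tautological one or its transpose. -/
lemma eq_lineProj_or_transpose (hQ : IsStandardFrameMap Q) (hn : 3 ≤ n)
    (hone : ∀ i j, i ≠ j → rangeSlope Q i j 1 = 1) :
    (∀ v, v ≠ 0 → Q v = lineProj v) ∨ ∀ v, v ≠ 0 → Q v = (lineProj v)ᵀ := by
  obtain ⟨g, hg, hgT, hg'⟩ := hQ.slope_eq_id_or_star hn hone
  have hg1 : g 1 = 1 := by rcases hg' with h | h <;> simp [h]
  have hentry : ∀ v : Fin n → ℂ, ∀ m, v m ≠ 0 → ∀ i j,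
      Q v i j = g (v i / v m) * g (star (v j / v m)) * Q v m m := by
    intro v m hm i j
    have h1 : Q v i j = g (v i / v m) * Q v m j := by
      by_cases him : i = m
      · rw [him, div_self hm, hg1, one_mul]
      · rw [← hg m i (Ne.symm him)]
        exact hQ.row_eq_slope_mul hn (Ne.symm him) hm j
    have h2 : Q v m j = g (star (v j / v m)) * Q v m m := by
      by_cases hjm : j = m
      · rw [hjm, div_self hm, star_one, hg1, one_mul]
      · rw [← hgT m j (Ne.symm hjm)]
        exact hQ.transpose.row_eq_slope_mul hn (Ne.symm hjm) hm m
    rw [h1, h2, mul_assoc]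
  have hdiag : ∀ v : Fin n → ℂ, v ≠ 0 → ∀ m, v m ≠ 0 →
      Q v m m = v m * star (v m) / (star v ⬝ᵥ v) := by
    intro v hv m hm
    have hsm : star (v m) ≠ 0 := star_ne_zero.2 hm
    have hgg : ∀ s, g s * g (star s) = s * star s := fun s => by
      rcases hg' with h | h
      · rw [h, h]
      · rw [h, h, star_star, mul_comm]
    have h1 : ∑ i, Q v i i = (star v ⬝ᵥ v) * Q v m m / (v m * star (v m)) := by
      rw [dotProduct, Finset.sum_mul, Finset.sum_div]
      refine Finset.sum_congr rfl fun i _ => ?_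
      rw [hentry v m hm i i, hgg, star_div₀, Pi.star_apply]
      field_simp
    rw [hQ.trace_eq_one hn hv] at h1
    rw [eq_div_iff (dotProduct_star_self_ne_zero hv), mul_comm]
    exact ((div_eq_one_iff_eq (mul_ne_zero hm hsm)).1 h1.symm)
  refine hg'.imp (fun h v hv => ?_) fun h v hv => ?_
  all_goals
    obtain ⟨m, hm'⟩ := Function.ne_iff.1 hv
    have hm : v m ≠ 0 := hm'
    have hsm : star (v m) ≠ 0 := star_ne_zero.2 hm
    have hd := dotProduct_star_self_ne_zero hv
    ext i j
    rw [hentry v m hm i j, h, h, hdiag v hv m hm]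
    simp only [transpose_apply, lineProj, Matrix.smul_apply, vecMulVec_apply, Pi.star_apply,
      smul_eq_mul, star_div₀, star_star]
    field_simp

end IsStandardFrameMap

/-- A continuous analogue of the theorem of Wigner and Uhlhorn: up to conjugation, frame maps are
the tautological one and its transpose. -/
theorem IsFrameMap.exists_conj {n : ℕ} {Q : (Fin n → ℂ) → Matrix (Fin n) (Fin n) ℂ}
    (hQ : IsFrameMap Q) (hn : 3 ≤ n) :
    ∃ T : (Matrix (Fin n) (Fin n) ℂ)ˣ,
      (∀ v, v ≠ 0 → Q v = T.1 * lineProj v * T⁻¹.1) ∨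
      ∀ v, v ≠ 0 → Q v = T.1 * (lineProj v)ᵀ * T⁻¹.1 := by
  obtain ⟨S, hS⟩ := hQ.frame (fun i => Pi.single i 1) (fun i => by simp)
    (fun i j hij => by simp [hij])
  have hQ₁ : IsStandardFrameMap fun v => S⁻¹.1 * Q v * S.1 :=
    { toIsFrameMap := hQ.conj S
      apply_single := fun i => by rw [hS]; simp [mul_assoc] }
  set Q₁ : (Fin n → ℂ) → Matrix (Fin n) (Fin n) ℂ := fun v => S⁻¹.1 * Q v * S.1 with hQ₁def
  -- Rescale the basis so that the range at the all-ones vector `u` is spanned by `u`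
  set u : Fin n → ℂ := fun _ => 1 with hu
  have hui : ∀ i, u i ≠ 0 := fun i => one_ne_zero
  set z : Fin n := ⟨0, by omega⟩
  set x : Fin n → ℂ := fun i => Q₁ u i z with hx
  have hx0 : ∀ i, x i ≠ 0 := fun i => hQ₁.entry_ne_zero hn (hui i) (hui z)
  set D : (Matrix (Fin n) (Fin n) ℂ)ˣ := ⟨diagonal x, diagonal fun i => (x i)⁻¹,
    by simp [hx0], by simp [hx0]⟩ with hD
  have hDv : D.1 = diagonal x := rfl
  have hDi : D⁻¹.1 = diagonal fun i => (x i)⁻¹ := rfl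
  have hentry : ∀ v i j, (D⁻¹.1 * Q₁ v * D.1) i j = (x i)⁻¹ * Q₁ v i j * x j := by
    intro v i j
    rw [hDv, hDi, mul_diagonal, diagonal_mul]
  have hQ₂ : IsStandardFrameMap fun v => D⁻¹.1 * Q₁ v * D.1 :=
    { toIsFrameMap := hQ₁.toIsFrameMap.conj D
      apply_single := fun i => by
        rw [hQ₁.apply_single]
        ext k l
        rw [mul_single_mul_apply, hDv, hDi]
        by_cases hk : k = i
        · by_cases hl : l = i
          · subst hk; subst hl; simp [hx0]
          · simp [Ne.symm hl]
        · simp [hk, Ne.symm hk] }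
  have hone : ∀ i j, i ≠ j → rangeSlope (fun v => D⁻¹.1 * Q₁ v * D.1) i j 1 = 1 := by
    intro i j hij
    have h1 := hQ₂.row_eq_slope_mul hn hij (hui i) z
    have h2 : u j / u i = 1 := by simp [hu]
    simp only [hentry, h2] at h1
    change (x j)⁻¹ * x j * x z = _ * ((x i)⁻¹ * x i * x z) at h1
    rw [inv_mul_cancel₀ (hx0 i), inv_mul_cancel₀ (hx0 j), one_mul] at h1
    exact (mul_right_cancel₀ (hx0 z) (by rw [one_mul]; exact h1)).symm
  have hback : ∀ v, Q v = (S * D).1 * (D⁻¹.1 * Q₁ v * D.1) * ((S * D)⁻¹).1 := by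
    intro v
    simp only [hQ₁def, _root_.mul_inv_rev, Units.val_mul, mul_assoc, Units.mul_inv_cancel_left,
      Units.mul_inv, mul_one]
  refine ⟨S * D, ?_⟩
  rcases hQ₂.eq_lineProj_or_transpose hn hone with h | h
  · left
    intro v hv
    rw [hback, h v hv]
  · right
    intro v hv
    rw [hback, h v hv]

/-! ### From matrices to lines and back -/

lemma lineProj_col {n : ℕ} {U : Matrix (Fin n) (Fin n) ℂ} (hU : U ∈ unitaryGroup (Fin n) ℂ)
    (k : Fin n) : lineProj (fun i => U i k) = U * single k k (1 : ℂ) * star U := by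
  have h : (star fun i => U i k) ⬝ᵥ (fun i => U i k) = 1 := by
    have := congrFun (congrFun (mem_unitaryGroup_iff'.1 hU) k) k
    rwa [one_apply_eq, mul_apply] at this
  ext i j
  rw [mul_single_mul_apply, lineProj, h, inv_one, one_smul, vecMulVec_apply, star_apply,
    Pi.star_apply]

lemma mul_diagonal_mul_eq_sum {n : ℕ} (A B : Matrix (Fin n) (Fin n) ℂ) (d : Fin n → ℂ) :
    A * diagonal d * B = ∑ k, d k • (A * single k k (1 : ℂ) * B) := by
  ext i j
  rw [Matrix.sum_apply, mul_apply]
  refine Finset.sum_congr rfl fun k _ => ?_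
  rw [mul_diagonal, Matrix.smul_apply, mul_single_mul_apply, smul_eq_mul]
  ring

lemma diagonal_ite_eq {n : ℕ} (a b : ℂ) (k : Fin n) :
    diagonal (fun i => if i = k then b else a) =
      a • (1 : Matrix (Fin n) (Fin n) ℂ) + (b - a) • single k k (1 : ℂ) := by
  ext i j
  by_cases hij : i = j
  · subst hij
    by_cases hik : i = k
    · subst hik; simp
    · simp [hik, Ne.symm hik]
  · have : ¬(k = i ∧ k = j) := fun h => hij (h.1.symm.trans h.2)
    simp [hij, this]

/-- The normal matrix with eigenvalue `b` on the line of `v` and `a` on its orthogonal complement. -/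
noncomputable def twoPoint {n : ℕ} (a b : ℂ) (v : Fin n → ℂ) : Matrix (Fin n) (Fin n) ℂ :=
  a • (1 : Matrix (Fin n) (Fin n) ℂ) + (b - a) • lineProj v

lemma twoPoint_eq {n : ℕ} {U : Matrix (Fin n) (Fin n) ℂ} (hU : U ∈ unitaryGroup (Fin n) ℂ)
    {v : Fin n → ℂ} {k : Fin n} (hv : lineProj v = U * single k k (1 : ℂ) * star U) (a b : ℂ) :
    twoPoint a b v = U * diagonal (fun i => if i = k then b else a) * star U := by
  rw [diagonal_ite_eq, twoPoint, hv, mul_add, add_mul, mul_smul_comm, mul_smul_comm,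
    smul_mul_assoc, smul_mul_assoc, mul_one, mem_unitaryGroup_iff.1 hU]

lemma exists_lineProj_eq_of_orthogonal {n : ℕ} (v : Fin n → Fin n → ℂ) (hv : ∀ i, v i ≠ 0)
    (ho : Pairwise fun i j => star (v i) ⬝ᵥ v j = 0) :
    ∃ U ∈ unitaryGroup (Fin n) ℂ, ∀ k, lineProj (v k) = U * single k k (1 : ℂ) * star U := by
  obtain ⟨U, hU, hUd⟩ := exists_unitary_of_orthogonal v hv ho
  refine ⟨U, hU, fun k => ?_⟩
  have h := hUd (Pi.single k 1)
  rw [diagonal_single] at h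
  rw [h, Finset.sum_eq_single k (fun i _ hi => by simp [hi]) (by simp)]
  simp

lemma twoPoint_mem {n : ℕ} (hn : 3 ≤ n) {Λ : Set ℂ} {a b : ℂ} (ha : a ∈ Λ) (hb : b ∈ Λ)
    {v : Fin n → ℂ} (hv : v ≠ 0) : twoPoint a b v ∈ normalMatrices n Λ := by
  obtain ⟨u, k, huk, hu, ho⟩ := exists_orthogonal_frame hn hv
  obtain ⟨U, hU, hUk⟩ := exists_lineProj_eq_of_orthogonal u hu ho
  rw [twoPoint_eq hU (huk ▸ hUk k)]
  refine mem_normalMatrices_of_unitary hU fun i => ?_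
  split_ifs <;> assumption

section

variable {n : ℕ} {Λ : Set ℂ} {φ : normalMatrices n Λ → Matrix (Fin n) (Fin n) ℂ}

open Classical in
/-- The map on lines induced by `φ`: the matrix with eigenvalue `b` on the line of `v` and `a` on
its orthogonal complement is sent by `φ` to `a + (b - a) • inducedMap φ a b v`. The value at
matrices outside the domain of `φ` is `0`. -/
noncomputable def inducedMap (φ : normalMatrices n Λ → Matrix (Fin n) (Fin n) ℂ) (a b : ℂ)
    (v : Fin n → ℂ) : Matrix (Fin n) (Fin n) ℂ :=
  if h : twoPoint a b v ∈ normalMatrices n Λ then (b - a)⁻¹ • (φ ⟨_, h⟩ - a • 1) else 0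

lemma inducedMap_eq {U : Matrix (Fin n) (Fin n) ℂ} (hU : U ∈ unitaryGroup (Fin n) ℂ)
    {T : (Matrix (Fin n) (Fin n) ℂ)ˣ}
    (hT : ∀ (d : Fin n → ℂ) (hd : ∀ i, d i ∈ Λ),
      φ ⟨U * diagonal d * star U, mem_normalMatrices_of_unitary hU hd⟩ =
        T.1 * diagonal d * T⁻¹.1) {a b : ℂ} (ha : a ∈ Λ) (hb : b ∈ Λ) (hab : a ≠ b)
    {v : Fin n → ℂ} {k : Fin n} (hv : lineProj v = U * single k k (1 : ℂ) * star U) :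
    inducedMap φ a b v = T.1 * single k k 1 * T⁻¹.1 := by
  have heq := twoPoint_eq hU hv a b
  have hd : ∀ i, (fun i => if i = k then b else a) i ∈ Λ := by
    intro i
    simp only
    split_ifs <;> assumption
  have hmem : twoPoint a b v ∈ normalMatrices n Λ := by
    rw [heq]; exact mem_normalMatrices_of_unitary hU hd
  have h1 : φ ⟨twoPoint a b v, hmem⟩ = T.1 * diagonal (fun i => if i = k then b else a) * T⁻¹.1 := by
    rw [← hT _ hd]
    congr 1
    exact Subtype.ext heq
  rw [inducedMap, dif_pos hmem, h1, diagonal_ite_eq, mul_add, add_mul]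
  have h3 : b - a ≠ 0 := sub_ne_zero.2 hab.symm
  simp only [mul_smul_comm, smul_mul_assoc, mul_one, Units.mul_inv, add_sub_cancel_left,
    smul_smul, inv_mul_cancel₀ h3, one_smul]

lemma isFrameMap_inducedMap (hn : 3 ≤ n) (hΛ : IsSimpleClosedCurve Λ) (hc : Continuous φ)
    (hcomm : PreservesCommutativity φ) (hspec : PreservesSpectrum φ) {a b : ℂ} (ha : a ∈ Λ)
    (hb : b ∈ Λ) (hab : a ≠ b) : IsFrameMap (inducedMap φ a b) where
  continuousOn := by
    rw [continuousOn_iff_continuous_domRestrict]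
    have hP : Continuous fun v : ({0}ᶜ : Set (Fin n → ℂ)) => twoPoint a b v.1 :=
      continuous_const.add ((continuousOn_iff_continuous_domRestrict.1
        continuousOn_lineProj).const_smul (b - a))
    have hφP : Continuous fun v : ({0}ᶜ : Set (Fin n → ℂ)) =>
        φ ⟨twoPoint a b v.1, twoPoint_mem hn ha hb v.2⟩ := hc.comp (hP.subtype_mk _)
    refine ((hφP.sub (continuous_const (y := a • 1))).const_smul (b - a)⁻¹).congr fun v => ?_
    change _ = inducedMap φ a b v.1
    rw [inducedMap, dif_pos (twoPoint_mem hn ha hb v.2)]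
    rfl
  smul c hc v := by
    have h : twoPoint a b (c • v) = twoPoint a b v := by
      rw [twoPoint, twoPoint, lineProj_smul c hc]
    unfold inducedMap
    generalize twoPoint a b (c • v) = A at h
    subst h
    rfl
  frame v hv ho := by
    obtain ⟨U, hU, hUk⟩ := exists_lineProj_eq_of_orthogonal v hv ho
    obtain ⟨T, hT⟩ := exists_conj_on_diagonal hΛ hc hcomm hspec hU
    exact ⟨T, fun i => inducedMap_eq hU hT ha hb hab (hUk i)⟩

lemma IsSimpleClosedCurve.exists_ne (hΛ : IsSimpleClosedCurve Λ) :
    ∃ a ∈ Λ, ∃ b ∈ Λ, a ≠ b := by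
  obtain ⟨e⟩ := hΛ
  refine ⟨_, (e.symm 1).2, _, (e.symm (Circle.exp Real.pi)).2, fun h => ?_⟩
  have h1 : (1 : Circle) = Circle.exp Real.pi := e.symm.injective (Subtype.ext h)
  have h2 := congrArg (fun z : Circle => (z : ℂ)) h1
  simp only [Circle.coe_one, Circle.coe_exp, Complex.exp_pi_mul_I] at h2
  norm_num at h2

/-- By the spectral theorem, `φ` is determined by the induced map on lines, whose conjugating matrix
therefore serves for `φ`. -/
theorem conjugation_or_transpose (hn : 3 ≤ n) (hΛ : IsSimpleClosedCurve Λ) (hc : Continuous φ)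
    (hcomm : PreservesCommutativity φ) (hspec : PreservesSpectrum φ) :
    IsConjugation φ ∨ IsTransposeConjugation φ := by
  obtain ⟨a, ha, b, hb, hab⟩ := hΛ.exists_ne
  obtain ⟨S, hS⟩ := (isFrameMap_inducedMap hn hΛ hc hcomm hspec ha hb hab).exists_conj hn
  have key : ∀ X : normalMatrices n Λ, ∃ (d : Fin n → ℂ) (u : Fin n → Fin n → ℂ),
      (∀ k, u k ≠ 0) ∧ X.1 = ∑ k, d k • lineProj (u k) ∧
        φ X = ∑ k, d k • inducedMap φ a b (u k) := by
    intro X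
    obtain ⟨U, hU, d, hX⟩ := exists_unitary_diagonalization X.1 X.2.1
    have hd : ∀ i, d i ∈ Λ := by
      intro i
      apply X.2.2
      have := Unitary.spectrum_star_right_conjugate (R := ℂ) (a := diagonal d) (U := ⟨U, hU⟩)
      simp only at this
      rw [hX, this, spectrum_diagonal]
      exact ⟨i, rfl⟩
    obtain ⟨T, hT⟩ := exists_conj_on_diagonal hΛ hc hcomm hspec hU
    have hXU : X = ⟨U * diagonal d * star U, mem_normalMatrices_of_unitary hU hd⟩ :=
      Subtype.ext hX
    refine ⟨d, fun k i => U i k, fun k hk => ?_, ?_, ?_⟩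
    · have := congrFun (congrFun (mem_unitaryGroup_iff'.1 hU) k) k
      rw [one_apply_eq, mul_apply] at this
      simp only [fun i => show U i k = 0 from congrFun hk i] at this
      simp at this
    · simp only [lineProj_col hU]
      rw [hX, mul_diagonal_mul_eq_sum]
    · simp only [fun k => inducedMap_eq hU hT ha hb hab (lineProj_col hU k)]
      rw [hXU, hT d hd, mul_diagonal_mul_eq_sum]
  rcases hS with hS | hS
  · left
    refine ⟨S, fun X => ?_⟩
    obtain ⟨d, u, hu, hX, hφ⟩ := key X
    rw [hφ, hX, Finset.mul_sum, Finset.sum_mul]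
    exact Finset.sum_congr rfl fun k _ => by rw [hS _ (hu k), mul_smul_comm, smul_mul_assoc]
  · right
    refine ⟨S, fun X => ?_⟩
    obtain ⟨d, u, hu, hX, hφ⟩ := key X
    rw [hφ, hX, transpose_sum, Finset.mul_sum, Finset.sum_mul]
    exact Finset.sum_congr rfl fun k _ => by
      rw [hS _ (hu k), transpose_smul, mul_smul_comm, smul_mul_assoc]

end

/-! ### Conjugations and orderings of spectra -/

lemma spectrum_transpose_eq {n : ℕ} (X : Matrix (Fin n) (Fin n) ℂ) :
    spectrum ℂ Xᵀ = spectrum ℂ X := by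
  ext μ
  rw [spectrum.mem_iff, spectrum.mem_iff, ← isUnit_transpose]
  simp [algebraMap_eq_diagonal]

lemma commute_conj_iff {n : ℕ} (T : (Matrix (Fin n) (Fin n) ℂ)ˣ) (X Y : Matrix (Fin n) (Fin n) ℂ) :
    Commute (T.1 * X * T⁻¹.1) (T.1 * Y * T⁻¹.1) ↔ Commute X Y := by
  have h : ∀ A B : Matrix (Fin n) (Fin n) ℂ,
      T.1 * A * T⁻¹.1 * (T.1 * B * T⁻¹.1) = T.1 * (A * B) * T⁻¹.1 := fun A B => by
    simp only [mul_assoc, Units.inv_mul_cancel_left]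
  rw [commute_iff_eq, commute_iff_eq, h, h, Units.mul_left_inj, Units.mul_right_inj]

lemma commute_transpose_iff {n : ℕ} (X Y : Matrix (Fin n) (Fin n) ℂ) :
    Commute Xᵀ Yᵀ ↔ Commute X Y := by
  rw [commute_iff_eq, commute_iff_eq, ← transpose_mul, ← transpose_mul, transpose_inj, eq_comm]

section

variable {n : ℕ} {D : Set (Matrix (Fin n) (Fin n) ℂ)} {φ : D → Matrix (Fin n) (Fin n) ℂ}

lemma IsConjugation.preserves (h : IsConjugation φ) :
    Continuous φ ∧ PreservesCommutativity φ ∧ PreservesSpectrum φ := by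
  obtain ⟨T, hT⟩ := h
  refine ⟨?_, fun X Y hXY => ?_, fun X => ?_⟩
  · rw [funext hT]
    exact (continuous_const.mul continuous_subtype_val).mul continuous_const
  · rw [hT, hT, commute_conj_iff]; exact hXY
  · rw [hT, spectrum.units_conjugate]

lemma IsTransposeConjugation.preserves (h : IsTransposeConjugation φ) :
    Continuous φ ∧ PreservesCommutativity φ ∧ PreservesSpectrum φ := by
  obtain ⟨T, hT⟩ := h
  refine ⟨?_, fun X Y hXY => ?_, fun X => ?_⟩
  · rw [funext hT]
    exact (continuous_const.mul continuous_subtype_val.matrix_transpose).mul continuous_const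
  · rw [hT, hT, commute_conj_iff, commute_transpose_iff]; exact hXY
  · rw [hT, spectrum.units_conjugate, spectrum_transpose_eq]

lemma commute_of_commute_apply (h : IsConjugation φ ∨ IsTransposeConjugation φ) {X Y : D}
    (hXY : Commute (φ X) (φ Y)) : Commute X.1 Y.1 := by
  rcases h with ⟨T, hT⟩ | ⟨T, hT⟩
  · rwa [hT, hT, commute_conj_iff] at hXY
  · rwa [hT, hT, commute_conj_iff, commute_transpose_iff] at hXY

/-- An ordering of spectra has commuting values. -/
lemma IsSpectrumOrdering.commute {I : Set ℝ} {γ : ℝ → ℂ} (h : IsSpectrumOrdering I γ φ) (X Y : D) :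
    Commute (φ X) (φ Y) := by
  obtain ⟨T, hT⟩ := h
  obtain ⟨t, -, -, -, ht⟩ := hT X
  obtain ⟨s, -, -, -, hs⟩ := hT Y
  rw [ht, hs, commute_conj_iff]
  exact commute_diagonal _ _

end

/-- The matrices `twoPoint a b v` and `twoPoint a b w` for lines at an angle of 45 degrees do not
commute. -/
lemma exists_not_commute {n : ℕ} (hn : 3 ≤ n) {Λ : Set ℂ} (hΛ : IsSimpleClosedCurve Λ) :
    ∃ X Y : normalMatrices n Λ, ¬Commute X.1 Y.1 := by
  obtain ⟨a, ha, b, hb, hab⟩ := hΛ.exists_ne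
  set i : Fin n := ⟨0, by omega⟩
  set j : Fin n := ⟨1, by omega⟩
  have hij : i ≠ j := by simp [i, j]
  have hv := planeVec_ne_zero_left hij one_ne_zero 0
  have hw := planeVec_ne_zero_left hij one_ne_zero 1
  refine ⟨⟨_, twoPoint_mem hn ha hb hv⟩, ⟨_, twoPoint_mem hn ha hb hw⟩, fun h => ?_⟩
  have hba : b - a ≠ 0 := sub_ne_zero.2 hab.symm
  have h1 : lineProj (planeVec i j 1 0) = single i i 1 := by
    rw [lineProj, star_planeVec_dotProduct]
    ext k l
    by_cases hk : k = i
    · by_cases hl : l = i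
      · subst hk; subst hl; simp [planeVec, vecMulVec_apply]
      · simp [planeVec, vecMulVec_apply, hl, Ne.symm hl]
    · simp [planeVec, vecMulVec_apply, hk, Ne.symm hk]
  have h2 : Commute (lineProj (planeVec i j 1 0)) (lineProj (planeVec i j 1 1)) := by
    have h3 := h.eq
    simp only [twoPoint, add_mul, mul_add, smul_mul_assoc, mul_smul_comm, one_mul, mul_one] at h3
    have h4 : ((b - a) * (b - a)) • (lineProj (planeVec i j 1 0) * lineProj (planeVec i j 1 1)) =
        ((b - a) * (b - a)) • (lineProj (planeVec i j 1 1) * lineProj (planeVec i j 1 0)) := by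
      rw [← sub_eq_zero] at h3 ⊢
      rw [← h3]
      module
    exact smul_right_injective _ (mul_ne_zero hba hba) h4
  have h5 := congrFun (congrFun h2.eq i) j
  rw [h1, single_mul_apply_same, mul_single_apply_of_ne _ _ _ _ _ hij.symm, one_mul, lineProj,
    Matrix.smul_apply, vecMulVec_apply, Pi.star_apply, planeVec_left hij, planeVec_right hij,
    star_planeVec_dotProduct, planeVec_left hij, planeVec_right hij] at h5
  norm_num at h5

-- The operator norm makes the matrices a C⋆-algebra.
open scoped Matrix.Norms.L2Operator in
lemma unitaryGroup_eq_normalMatrices (n : ℕ) :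
    (unitaryGroup (Fin n) ℂ : Set (Matrix (Fin n) (Fin n) ℂ)) =
      normalMatrices n (unitary ℂ : Set ℂ) := by
  ext X
  exact unitary_iff_isStarNormal_and_spectrum_subset_unitary

lemma isSimpleClosedCurve_unitary : IsSimpleClosedCurve (unitary ℂ : Set ℂ) := by
  have h : (unitary ℂ : Set ℂ) = (Submonoid.unitSphere ℂ : Set ℂ) := by
    ext z
    have h1 : star z * z = 1 ↔ ‖z‖ = 1 := by
      rw [Complex.star_def, Complex.conj_mul', ← Complex.ofReal_pow, Complex.ofReal_eq_one,
        pow_eq_one_iff_of_nonneg (norm_nonneg z) two_ne_zero]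
    rw [SetLike.mem_coe, Unitary.mem_iff, mul_comm z, and_self_iff, h1]
    exact mem_sphere_zero_iff_norm.symm
  exact ⟨Homeomorph.setCongr h⟩

theorem theorem2 (n : ℕ) (hn : 3 ≤ n) :
    (∀ Λ : Set ℂ, IsSimpleClosedCurve Λ →
      ∀ φ : normalMatrices n Λ → Matrix (Fin n) (Fin n) ℂ,
        ((Continuous φ ∧ PreservesCommutativity φ ∧ PreservesSpectrum φ) ↔
          (IsConjugation φ ∨ IsTransposeConjugation φ)) ∧
        ((Continuous φ ∧ PreservesCommutativity φ ∧ PreservesSpectrum φ) →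
          ∀ (I : Set ℝ) (γ : ℝ → ℂ), I.OrdConnected → ContinuousOn γ I → Set.InjOn γ I →
            γ '' I = Λ → ¬ IsSpectrumOrdering I γ φ)) ∧
    (∀ φ : (Matrix.unitaryGroup (Fin n) ℂ : Set (Matrix (Fin n) (Fin n) ℂ)) →
        Matrix (Fin n) (Fin n) ℂ,
      (Continuous φ ∧ PreservesCommutativity φ ∧ PreservesSpectrum φ) ↔
        (IsConjugation φ ∨ IsTransposeConjugation φ)) := by
  have hiff : ∀ Λ : Set ℂ, IsSimpleClosedCurve Λ → ∀ D, D = normalMatrices n Λ →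
      ∀ φ : D → Matrix (Fin n) (Fin n) ℂ,
        ((Continuous φ ∧ PreservesCommutativity φ ∧ PreservesSpectrum φ) ↔
          (IsConjugation φ ∨ IsTransposeConjugation φ)) := by
    rintro Λ hΛ _ rfl φ
    exact ⟨fun ⟨h1, h2, h3⟩ => conjugation_or_transpose hn hΛ h1 h2 h3,
      fun h => h.elim IsConjugation.preserves IsTransposeConjugation.preserves⟩
  refine ⟨fun Λ hΛ φ => ⟨hiff Λ hΛ _ rfl φ, fun h I γ _ _ _ _ hord => ?_⟩,
    hiff _ isSimpleClosedCurve_unitary _ (unitaryGroup_eq_normalMatrices n)⟩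
  obtain ⟨X, Y, hXY⟩ := exists_not_commute hn hΛ
  exact hXY (commute_of_commute_apply ((hiff Λ hΛ _ rfl φ).1 h) (hord.commute X Y))
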